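/- For a finite connected graph $G$, the Mostar index is $Mo(G)=\sum_{uv\in E(G)}|n_u-n_v|$, where $n_u$ (resp. $n_v$) is the number of vertices of $G$ that are strictly closer to $u$ than to $v$ (resp. strictly closer to $v$ than to $u$). For $h\ge 1$, a *tree-like phenylene with $h$ hexagons* is a connected graph that is composed of $h$ hexagons (6-cycles) and $h-1$ quadrilaterals (4-cycles), in the sense that every vertex lies on a hexagon and the edges of the graph are exactly the edges of the hexagons and of the quadrilaterals, where the hexagons are pairwise vertex-disjoint, the quadrilaterals are pairwise vertex-disjoint, and each quadrilateral shares an edge with exactly two hexagons. (Such a graph is planar and 2-connected.) Let $\mathscr P_h$ be the class of these graphs. The *linear phenylene chain* $L_h$ is the graph consisting of hexagons $R_1,\dots,R_h$ and, for each $1\le i<h$, a quadrilateral joining an edge of $R_i$ to an edge of $R_{i+1}$, such that for $1<i<h$ the two quadrilaterals at $R_i$ contain opposite edges of $R_i$. **Theorem.** Let $h\ge 1$. Then $L_h\in\mathscr P_h$ and $$Mo(L_h)=72\left\lfloor\tfrac h2\right\rfloor\left\lceil\tfrac h2\right\rceil-24\left\lfloor\tfrac h2\right\rfloor .$$ For every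 $G\in\mathscr P_h$ we have $Mo(G)\ge Mo(L_h)$, with equality if and only if $G\cong L_h$. -/

import Mathlib

/-- For vertices `u`, `v` of `G`, the number `n_u` of vertices that are strictly closer to `u`
than to `v`. -/
noncomputable def closerCount {V : Type*} (G : SimpleGraph V) (u v : V) : ℕ :=
  {w : V | G.dist w u < G.dist w v}.ncard

open Classical in
/-- The Mostar index `Mo(G) = ∑_{uv ∈ E(G)} |n_u - n_v|` of a finite graph. -/
noncomputable def mostarIndex {V : Type*} [Fintype V] (G : SimpleGraph V) : ℤ :=
  ∑ e ∈ G.edgeFinset, Sym2.lift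
    ⟨fun u v => |(closerCount G u v : ℤ) - (closerCount G v u : ℤ)|,
      fun _ _ => abs_sub_comm _ _⟩ e

/-- The edges of the closed polygon `c 0, c 1, …, c (n - 1), c 0`. (Addition in `Fin n` is modulo
`n`, so that the last vertex is followed by `c 0`.) -/
def polygonEdges {V : Type*} {n : ℕ} [NeZero n] (c : Fin n → V) : Set (Sym2 V) :=
  Set.range fun k : Fin n => s(c k, c (k + 1))

/-- `G` is composed of the `h` hexagons `hex i` and the `h - 1` quadrilaterals `quad j`, in the way
a tree-like phenylene is. There is one quadrilateral fewer than there are hexagons and `G` is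
connected, so the hexagons, linked by the quadrilaterals, form a tree. Hence `G` is
automatically planar (with these polygons as its inner faces) and 2-connected. -/
structure IsTreeLikePhenyleneWith {V : Type*} (G : SimpleGraph V) (h : ℕ)
    (hex : Fin h → Fin 6 → V) (quad : Fin (h - 1) → Fin 4 → V) : Prop where
  /-- Each hexagon has six different vertices, the hexagons are mutually disjoint, and every
  vertex lies on one of them. -/
  hex_bijective : Function.Bijective fun p : Fin h × Fin 6 => hex p.1 p.2
  /-- Each quadrilateral has four different vertices and no two quadrilaterals meet (in particular,
  every vertex of `G` has degree 2 or 3). -/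
  quad_injective : Function.Injective fun p : Fin (h - 1) × Fin 4 => quad p.1 p.2
  /-- The edges of `G` are the edges of the hexagons and of the quadrilaterals. -/
  adj_iff : ∀ u v : V, G.Adj u v ↔
    (∃ i, s(u, v) ∈ polygonEdges (hex i)) ∨ (∃ j, s(u, v) ∈ polygonEdges (quad j))
  /-- Each quadrilateral is joined to (shares an edge with) exactly two hexagons. -/
  joined : ∀ j, {i | (polygonEdges (hex i) ∩ polygonEdges (quad j)).Nonempty}.ncard = 2
  connected : G.Connected

/-- `G` belongs to the class of tree-like phenylenes with `h` hexagons and `h - 1`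
quadrilaterals. -/
def IsTreeLikePhenylene {V : Type*} (G : SimpleGraph V) (h : ℕ) : Prop :=
  ∃ (hex : Fin h → Fin 6 → V) (quad : Fin (h - 1) → Fin 4 → V),
    IsTreeLikePhenyleneWith G h hex quad

/-- The linear phenylene chain `L_h`. Hexagon `i` has the vertices `(i, 0), …, (i, 5)` in cyclic
order. The quadrilateral between the hexagons `i` and `i + 1` has the vertices
`(i, 0), (i, 1), (i + 1, 3), (i + 1, 4)`, so that the two quadrilaterals at an inner hexagon sit on
the opposite edges `{0, 1}` and `{3, 4}` of it: there are no turn-hexagons and no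
full-hexagons. -/
def linearPhenylene (h : ℕ) : SimpleGraph (Fin h × Fin 6) :=
  SimpleGraph.fromRel fun x y =>
    (x.1 = y.1 ∧ y.2 = x.2 + 1) ∨
    (x.1.val + 1 = y.1.val ∧ ((x.2 = 0 ∧ y.2 = 4) ∨ (x.2 = 1 ∧ y.2 = 3)))

/-!
The edges of a tree-like phenylene are the `6h` edges of its hexagons and two rungs in each of its
`h - 1` quadrilaterals, and the hexagons form a tree `D` in which linked hexagons are adjacent.

*Lower bound.* Choose a hexagon `r` that minimizes the sum of the distances to all hexagons in `D`,
and let `s v` be the number of hexagons in the subtree of `v` with respect to the root `r`. Let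
`v ≠ r`. All paths between `v` and the `h - s v` hexagons outside its subtree go through one edge
`a` of `v`. Hence, if `e` is one of the four edges of `v` that are not parallel to `a`, all vertices
of these hexagons and half of the vertices of `v` are closer to the same end of `e`, so that `e`
contributes at least `6 (h - 2 s v + 1)` to the Mostar index. A rung between `v` and its parent
contributes at least `6 (h - 2 s v)`. No exact value is needed for the edges parallel to `a`, whose
cuts may run through many hexagons (`HexTree.le_mostarIndex`). As the `s v` add up to the sum of
the levels of all hexagons, the bound gets better if this sum gets smaller. By the choice of `r`, no
branch at `r` has more than `h / 2` hexagons (`HexTree.two_mul_card_sub_le`), and the levels that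
occur in a branch, or in a union of branches, have no gaps (`two_mul_sum_level_le`). This
bounds the sum of the levels by its value for a path that is rooted in the middle. If a branch has
exactly `h / 2` hexagons, the edges of `r` contribute, too
(`HexTree.linearMostar_le_of_balanced`).

*Equality.* If a second link at `v` is not opposite to `a`, an outer neighbour at that link is
closer to the same end of an edge as all the vertices above, and the bound is strict
(`lt_closerDiff_of_gate`). With the equality case of the bound for the levels this shows that for
equality every hexagon has at most two links, which are opposite to each other (`IsStraight`).
Then the tree can be rooted at a leaf, every level consists of one hexagon, and the levels and
suitable positions in the hexagons are the coordinates of an isomorphism with the linear chain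
(`nonempty_iso_linearPhenylene`).

*The linear chain.* The cut through all its hexagons is balanced because of a reflection, and all
other cuts separate the hexagons before some place from those after it
(`mostarIndex_linearPhenylene`).
-/

namespace Phenylene

open Finset

/-! ### Distances across a cut -/

section Cut

variable {V : Type*} {G : SimpleGraph V}

theorem exists_adj_dist_add_one (hG : G.Connected) {x w : V} (hne : x ≠ w) :
    ∃ y, G.Adj x y ∧ G.dist y w + 1 = G.dist x w := by
  obtain ⟨p, hp⟩ := hG.exists_walk_length_eq_dist x w
  cases p with
  | nil => exact absurd rfl hne
  | cons hadj q =>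
    rename_i y
    refine ⟨y, hadj, ?_⟩
    have h1 : G.dist y w ≤ q.length := SimpleGraph.dist_le q
    have h2 : G.dist x w ≤ G.dist x y + G.dist y w := hG.dist_triangle
    rw [SimpleGraph.dist_eq_one_iff_adj.2 hadj] at h2
    rw [SimpleGraph.Walk.length_cons] at hp
    omega

/-- A shortest path from a point of `X` to a point outside `X` leaves `X` along some edge. -/
theorem exists_crossing (hG : G.Connected) {X : Set V} {x w : V} (hx : x ∈ X) (hw : w ∉ X) :
    ∃ y ∈ X, ∃ z ∉ X, G.Adj y z ∧ G.dist x y + 1 + G.dist z w ≤ G.dist x w := by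
  induction hn : G.dist x w generalizing x with
  | zero =>
    rw [hG.dist_eq_zero_iff] at hn
    exact absurd (hn ▸ hx) hw
  | succ n ih =>
    obtain ⟨y, hxy, hd⟩ := exists_adj_dist_add_one hG (x := x) (w := w) (fun h => hw (h ▸ hx))
    by_cases hy : y ∈ X
    · obtain ⟨a, ha, b, hb, hab, hle⟩ := ih hy (by omega)
      refine ⟨a, ha, b, hb, hab, ?_⟩
      have h2 : G.dist x a ≤ G.dist x y + G.dist y a := hG.dist_triangle
      rw [SimpleGraph.dist_eq_one_iff_adj.2 hxy] at h2
      omega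
    · refine ⟨x, hx, y, hy, hxy, ?_⟩
      rw [SimpleGraph.dist_self]
      omega

/-- If every edge that leaves `X` ends in `a` or `b`, and `a` and `b` are closer to `u` than to
`w`, then so is every point of `X`. -/
theorem dist_lt_dist_of_gate (hG : G.Connected) {X : Set V} {a b u w x : V}
    (hX : ∀ y ∈ X, ∀ z ∉ X, G.Adj y z → z = a ∨ z = b) (hw : w ∉ X)
    (ha : G.dist a u < G.dist a w) (hb : G.dist b u < G.dist b w) (hx : x ∈ X) :
    G.dist x u < G.dist x w := by
  obtain ⟨y, hy, z, hz, hyz, hle⟩ := exists_crossing hG hx hw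
  have h1 : G.dist x u ≤ G.dist x y + G.dist y u := hG.dist_triangle
  have h2 : G.dist y u ≤ G.dist y z + G.dist z u := hG.dist_triangle
  rw [SimpleGraph.dist_eq_one_iff_adj.2 hyz] at h2
  have h3 : G.dist z u < G.dist z w := by
    rcases hX y hy z hz hyz with rfl | rfl <;> assumption
  omega

/-- If only the two rungs `a' a` and `b' b` leave `X`, and `a'`, `b'` are adjacent, then every
point of `X` is closer to `a'` than to `a`. -/
theorem dist_lt_dist_of_rungs (hG : G.Connected) {X : Set V} {a a' b b' x : V}
    (hX : ∀ y ∈ X, ∀ z ∉ X, G.Adj y z → (y = a' ∧ z = a) ∨ (y = b' ∧ z = b)) (ha : a ∉ X)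
    (hab : a ≠ b) (hab' : G.Adj a' b') (hx : x ∈ X) :
    G.dist x a' < G.dist x a := by
  obtain ⟨y, hy, z, hz, hyz, hle⟩ := exists_crossing hG hx ha
  rcases hX y hy z hz hyz with ⟨rfl, rfl⟩ | ⟨rfl, rfl⟩
  · omega
  · have h1 : G.dist x a' ≤ G.dist x y + G.dist y a' := hG.dist_triangle
    rw [SimpleGraph.dist_eq_one_iff_adj.2 hab'.symm] at h1
    have h2 := hG.pos_dist_of_ne hab.symm
    omega

theorem three_le_dist (hG : G.Connected) {x y : V} (hne : x ≠ y) (hadj : ¬G.Adj x y)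
    (hcommon : ∀ z, G.Adj x z → ¬G.Adj z y) : 3 ≤ G.dist x y := by
  obtain ⟨z, hxz, hd⟩ := exists_adj_dist_add_one hG hne
  have hzy : z ≠ y := fun h => hadj (h ▸ hxz)
  have := hG.one_lt_dist_of_ne_of_not_adj hzy (hcommon z hxz)
  omega

end Cut

/-! ### Contribution of an edge to the Mostar index -/

section CloserDiff

variable {V : Type*}

/-- The contribution `|n_u - n_v|` of the edge `uv` to the Mostar index. -/
noncomputable def closerDiff (G : SimpleGraph V) (u v : V) : ℤ :=
  |(closerCount G u v : ℤ) - (closerCount G v u : ℤ)|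

theorem closerDiff_comm (G : SimpleGraph V) (u v : V) : closerDiff G u v = closerDiff G v u :=
  abs_sub_comm _ _

theorem closerDiff_nonneg (G : SimpleGraph V) (u v : V) : 0 ≤ closerDiff G u v := abs_nonneg _

theorem closerCount_add_le [Fintype V] (G : SimpleGraph V) (u v : V) :
    closerCount G u v + closerCount G v u ≤ Fintype.card V := by
  unfold closerCount
  rw [← Set.ncard_union_eq, ← Nat.card_eq_fintype_card]
  · exact Set.ncard_le_card _
  · rw [Set.disjoint_left]
    intro w hw hw'
    simp only [Set.mem_ofPred_eq] at hw hw'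
    omega

theorem card_le_closerCount [Finite V] {G : SimpleGraph V} {u v : V} (S : Finset V)
    (hS : ∀ x ∈ S, G.dist x u < G.dist x v) : #S ≤ closerCount G u v := by
  rw [← Set.ncard_coe_finset S]
  exact Set.ncard_le_ncard hS (Set.toFinite _)

theorem le_closerDiff [Fintype V] {G : SimpleGraph V} {u v : V} (S : Finset V)
    (hS : ∀ x ∈ S, G.dist x u < G.dist x v) :
    2 * (#S : ℤ) - Fintype.card V ≤ closerDiff G u v := by
  have h1 := card_le_closerCount S hS
  have h2 := closerCount_add_le G u v
  refine le_trans ?_ (le_abs_self _)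
  zify at h1 h2
  linarith

theorem closerDiff_eq [Fintype V] [DecidableEq V] {G : SimpleGraph V} {u v : V} (S T : Finset V)
    (hS : ∀ x ∈ S, G.dist x u < G.dist x v) (hT : ∀ x ∈ T, G.dist x v < G.dist x u)
    (hST : #S + #T = Fintype.card V) :
    closerDiff G u v = |(#S : ℤ) - #T| := by
  have h1 := card_le_closerCount S hS
  have h2 := card_le_closerCount T hT
  have h3 := closerCount_add_le G u v
  unfold closerDiff
  rw [show closerCount G u v = #S by omega, show closerCount G v u = #T by omega]

theorem closerCount_iso {W : Type*} {G : SimpleGraph V} {H : SimpleGraph W} (f : G ≃g H)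
    (u v : V) : closerCount H (f u) (f v) = closerCount G u v := by
  unfold closerCount
  have hd : ∀ a b, H.dist (f a) (f b) = G.dist a b := by
    intro a b
    unfold SimpleGraph.dist
    congr 1
    unfold SimpleGraph.edist
    apply le_antisymm
    · refine le_iInf fun p => ?_
      refine iInf_le_of_le (p.map f.toHom) ?_
      simp
    · refine le_iInf fun p => ?_
      refine iInf_le_of_le ((p.map f.symm.toHom).copy (f.symm_apply_apply a)
        (f.symm_apply_apply b)) ?_
      simp
  rw [← Set.ncard_image_of_injective _ f.injective]
  congr 1
  ext w
  simp only [Set.mem_ofPred_eq, Set.mem_image]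
  constructor
  · intro hw
    refine ⟨f.symm w, ?_, f.apply_symm_apply w⟩
    rw [← hd, ← hd, f.apply_symm_apply]
    exact hw
  · rintro ⟨x, hx, rfl⟩
    rwa [hd, hd]

theorem closerDiff_iso {W : Type*} {G : SimpleGraph V} {H : SimpleGraph W} (f : G ≃g H)
    (u v : V) : closerDiff H (f u) (f v) = closerDiff G u v := by
  simp only [closerDiff, closerCount_iso]

/-- If an automorphism swaps the ends of an edge, the edge contributes nothing. -/
theorem closerDiff_eq_zero_of_swap {G : SimpleGraph V} (f : G ≃g G) {u v : V} (hu : f u = v)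
    (hv : f v = u) : closerDiff G u v = 0 := by
  have h := closerCount_iso f u v
  rw [hu, hv] at h
  simp [closerDiff, h]

theorem mostarIndex_iso {W : Type*} [Fintype V] [Fintype W] {G : SimpleGraph V}
    {H : SimpleGraph W} (f : G ≃g H) : mostarIndex G = mostarIndex H := by
  classical
  unfold mostarIndex
  refine Finset.sum_bij (fun e _ => e.map f) ?_ ?_ ?_ ?_
  · intro e he
    induction e with
    | _ u v =>
      rw [SimpleGraph.mem_edgeFinset, SimpleGraph.mem_edgeSet] at he
      rw [Sym2.map_mk, SimpleGraph.mem_edgeFinset, SimpleGraph.mem_edgeSet]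
      exact f.map_adj_iff.2 he
  · intro a _ b _ hab
    exact Sym2.map.injective f.injective hab
  · intro e he
    induction e with
    | _ u v =>
      refine ⟨s(f.symm u, f.symm v), ?_, by simp⟩
      rw [SimpleGraph.mem_edgeFinset, SimpleGraph.mem_edgeSet] at he ⊢
      exact f.symm.map_adj_iff.2 he
  · intro e _
    induction e with
    | _ u v => exact (closerDiff_iso f u v).symm

end CloserDiff

/-! ### Graphs made of linked hexagons -/

section HexMatching

variable {ι : Type*}

/-- A connected graph on hexagons `{v} × {0, …, 5}` whose other edges link different hexagons and
form a matching. -/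
structure IsHexMatching (G : SimpleGraph (ι × Fin 6)) : Prop where
  connected : G.Connected
  adj_same : ∀ v i j, G.Adj (v, i) (v, j) ↔ j = i + 1 ∨ i = j + 1
  unique : ∀ x y z, G.Adj x y → G.Adj x z → x.1 ≠ y.1 → x.1 ≠ z.1 → y = z

namespace IsHexMatching

variable {G : SimpleGraph (ι × Fin 6)} (hG : IsHexMatching G)

include hG

theorem not_adj_of_common_neighbor {v : ι} {i : Fin 6} {z : ι × Fin 6} (hz : z.1 ≠ v)
    (h : G.Adj (v, i) z) {j : Fin 6} (hij : i ≠ j) : ¬G.Adj z (v, j) := by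
  intro h'
  have := hG.unique z (v, i) (v, j) h.symm h' hz hz
  simp only [Prod.mk.injEq, true_and] at this
  exact hij this

theorem dist_add_one (v : ι) (i : Fin 6) : G.dist (v, i) (v, i + 1) = 1 :=
  SimpleGraph.dist_eq_one_iff_adj.2 ((hG.adj_same v _ _).2 (Or.inl rfl))

theorem dist_add_two_le (v : ι) (i : Fin 6) : G.dist (v, i) (v, i + 2) ≤ 2 := by
  have h1 := hG.dist_add_one v i
  have h2 := hG.dist_add_one v (i + 1)
  have h3 : G.dist (v, i) (v, i + 1 + 1) ≤ G.dist (v, i) (v, i + 1) + G.dist (v, i + 1) (v, i + 1 + 1) :=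
    hG.connected.dist_triangle
  rw [add_assoc, show (1 : Fin 6) + 1 = 2 from rfl] at h2 h3
  omega

theorem two_le_dist_add_two (v : ι) (i : Fin 6) : 2 ≤ G.dist (v, i) (v, i + 2) := by
  apply hG.connected.one_lt_dist_of_ne_of_not_adj
  · simp only [ne_eq, Prod.mk.injEq, true_and]
    revert i; decide
  · rw [hG.adj_same]
    revert i; decide

theorem three_le_dist_add_three (v : ι) (i : Fin 6) : 3 ≤ G.dist (v, i) (v, i + 3) := by
  have hne : i ≠ i + 3 := by revert i; decide
  apply three_le_dist hG.connected
  · simp [hne]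
  · rw [hG.adj_same]
    revert i; decide
  · rintro ⟨w, j⟩ hz
    by_cases hw : w = v
    · subst hw
      rw [hG.adj_same] at hz ⊢
      revert i j; decide
    · exact hG.not_adj_of_common_neighbor hw hz hne

/-- The three vertices of a hexagon on one side of an edge are closer to that end of the edge. -/
theorem dist_lt_of_half {v : ι} {i t : Fin 6} (ht : t = i ∨ t + 1 = i ∨ t + 2 = i) :
    G.dist (v, t) (v, i) < G.dist (v, t) (v, i + 1) := by
  rcases ht with rfl | rfl | rfl
  · rw [SimpleGraph.dist_self, hG.dist_add_one]
    omega
  · rw [add_assoc, show (1 : Fin 6) + 1 = 2 from rfl, hG.dist_add_one]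
    exact hG.two_le_dist_add_two v t
  · rw [add_assoc, show (2 : Fin 6) + 1 = 3 from rfl]
    have := hG.dist_add_two_le v t
    have := hG.three_le_dist_add_three v t
    omega

theorem dist_lt_of_half' {v : ι} {i t : Fin 6} (ht : t = i + 1 ∨ t = i + 2 ∨ t = i + 3) :
    G.dist (v, t) (v, i + 1) < G.dist (v, t) (v, i) := by
  simp only [SimpleGraph.dist_comm (u := (v, t))]
  rcases ht with rfl | rfl | rfl
  · rw [SimpleGraph.dist_self, hG.dist_add_one]
    omega
  · have h1 := hG.dist_add_one v (i + 1)
    rw [add_assoc, show (1 : Fin 6) + 1 = 2 from rfl] at h1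
    rw [h1]
    exact hG.two_le_dist_add_two v i
  · have h1 := hG.dist_add_two_le v (i + 1)
    rw [add_assoc, show (1 : Fin 6) + 2 = 3 from rfl] at h1
    have := hG.three_le_dist_add_three v i
    omega

/-- An outer neighbour of an end of a hexagon edge is closer to that end. -/
theorem dist_lt_of_outer {v : ι} {i j : Fin 6} (hij : i ≠ j) {y : ι × Fin 6} (hy : y.1 ≠ v)
    (h : G.Adj (v, i) y) : G.dist y (v, i) < G.dist y (v, j) := by
  rw [SimpleGraph.dist_eq_one_iff_adj.2 h.symm]
  apply hG.connected.one_lt_dist_of_ne_of_not_adj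
  · rintro rfl
    exact hy rfl
  · exact hG.not_adj_of_common_neighbor hy h hij

end IsHexMatching

/-- The set `X` of hexagons is attached to the rest of the graph only at the edge `{g, g + 1}` of
the hexagon `v`. -/
structure IsGate (G : SimpleGraph (ι × Fin 6)) (X : Finset ι) (v : ι) (g : Fin 6) : Prop where
  notMem : v ∉ X
  exit : ∀ y z, G.Adj y z → y.1 ∈ X → z.1 ∉ X → z = (v, g) ∨ z = (v, g + 1)

namespace IsGate

variable {G : SimpleGraph (ι × Fin 6)} {X : Finset ι} {v : ι} {g : Fin 6}

theorem dist_lt (hg : IsGate G X v g) (hG : IsHexMatching G) {i : Fin 6}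
    (hi : i = g + 1 ∨ i = g + 2) {x : ι × Fin 6} (hx : x.1 ∈ X) :
    G.dist x (v, i) < G.dist x (v, i + 1) := by
  refine dist_lt_dist_of_gate hG.connected (X := {x | x.1 ∈ X}) (a := (v, g)) (b := (v, g + 1))
    (fun y hy z hz hyz => hg.exit y z hyz hy hz) hg.notMem ?_ ?_ hx
  · apply hG.dist_lt_of_half
    clear * - hi; revert i g; decide
  · apply hG.dist_lt_of_half
    clear * - hi; revert i g; decide

theorem dist_lt' (hg : IsGate G X v g) (hG : IsHexMatching G) {i : Fin 6}
    (hi : i = g + 4 ∨ i = g + 5) {x : ι × Fin 6} (hx : x.1 ∈ X) :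
    G.dist x (v, i + 1) < G.dist x (v, i) := by
  refine dist_lt_dist_of_gate hG.connected (X := {x | x.1 ∈ X}) (a := (v, g)) (b := (v, g + 1))
    (fun y hy z hz hyz => hg.exit y z hyz hy hz) hg.notMem ?_ ?_ hx
  · apply hG.dist_lt_of_half'
    clear * - hi; revert i g; decide
  · apply hG.dist_lt_of_half'
    clear * - hi; revert i g; decide

end IsGate

/-- The vertices of the hexagons in `X`, and the vertices of the hexagon `v` at positions in
`A`. -/
def region [DecidableEq ι] (X : Finset ι) (v : ι) (A : Finset (Fin 6)) : Finset (ι × Fin 6) :=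
  X ×ˢ univ ∪ {v} ×ˢ A

theorem mem_region [DecidableEq ι] {X : Finset ι} {v : ι} {A : Finset (Fin 6)} {x : ι × Fin 6} :
    x ∈ region X v A ↔ x.1 ∈ X ∨ (x.1 = v ∧ x.2 ∈ A) := by
  rw [region, mem_union, mem_product, mem_product]
  simp only [mem_univ, and_true, mem_singleton]

theorem card_region [DecidableEq ι] {X : Finset ι} {v : ι} (hv : v ∉ X) (A : Finset (Fin 6)) :
    #(region X v A) = 6 * #X + #A := by
  rw [region, card_union_of_disjoint, card_product, card_product]
  · simp [mul_comm]
  · rw [Finset.disjoint_left]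
    rintro ⟨a, b⟩ h1 h2
    simp only [mem_product, mem_univ, and_true, mem_singleton] at h1 h2
    exact hv (h2.1 ▸ h1)

/-- The half of a hexagon on the side of `i` of the edge `{i, i + 1}`. -/
def lowerHalf (i : Fin 6) : Finset (Fin 6) := {i, i + 5, i + 4}

/-- The half of a hexagon on the side of `i + 1` of the edge `{i, i + 1}`. -/
def upperHalf (i : Fin 6) : Finset (Fin 6) := {i + 1, i + 2, i + 3}

theorem card_lowerHalf (i : Fin 6) : #(lowerHalf i) = 3 := by revert i; decide

theorem card_upperHalf (i : Fin 6) : #(upperHalf i) = 3 := by revert i; decide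

variable {G : SimpleGraph (ι × Fin 6)} {X : Finset ι} {v : ι} {g : Fin 6}

theorem dist_lt_of_mem_lower [DecidableEq ι] (hG : IsHexMatching G) (hg : IsGate G X v g)
    {i : Fin 6} (hi : i = g + 1 ∨ i = g + 2) {x : ι × Fin 6} (hx : x ∈ region X v (lowerHalf i)) :
    G.dist x (v, i) < G.dist x (v, i + 1) := by
  rcases mem_region.1 hx with hx | ⟨h1, h2⟩
  · exact hg.dist_lt hG hi hx
  · obtain ⟨w, t⟩ := x
    subst h1
    apply hG.dist_lt_of_half
    change t ∈ lowerHalf i at h2; clear * - h2; revert i t; decide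

theorem dist_lt_of_mem_upper [DecidableEq ι] (hG : IsHexMatching G) (hg : IsGate G X v g)
    {i : Fin 6} (hi : i = g + 4 ∨ i = g + 5) {x : ι × Fin 6} (hx : x ∈ region X v (upperHalf i)) :
    G.dist x (v, i + 1) < G.dist x (v, i) := by
  rcases mem_region.1 hx with hx | ⟨h1, h2⟩
  · exact hg.dist_lt' hG hi hx
  · obtain ⟨w, t⟩ := x
    subst h1
    apply hG.dist_lt_of_half'
    simpa [upperHalf] using h2

variable [Fintype ι]

/-- A gate at the edge `{g, g + 1}` of a hexagon bounds the contribution of the four hexagon edges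
that are not parallel to it. -/
theorem le_closerDiff_of_gate (hG : IsHexMatching G) (hg : IsGate G X v g) {i : Fin 6}
    (hi : i ≠ g) (hi' : i ≠ g + 3) :
    12 * (#X : ℤ) + 6 - 6 * Fintype.card ι ≤ closerDiff G (v, i) (v, i + 1) := by
  classical
  have hcases : (i = g + 1 ∨ i = g + 2) ∨ (i = g + 4 ∨ i = g + 5) := by
    clear * - hi hi'; revert i g; decide
  rcases hcases with h | h
  · have := le_closerDiff (region X v (lowerHalf i)) fun x hx => dist_lt_of_mem_lower hG hg h hx
    rw [card_region hg.notMem, card_lowerHalf, Fintype.card_prod, Fintype.card_fin] at this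
    push_cast at this
    linarith
  · have := le_closerDiff (region X v (upperHalf i)) fun x hx => dist_lt_of_mem_upper hG hg h hx
    rw [card_region hg.notMem, card_upperHalf, Fintype.card_prod, Fintype.card_fin,
      closerDiff_comm] at this
    push_cast at this
    linarith

/-- If a hexagon with a gate at `{g, g + 1}` has outer neighbours at a further edge `{j, j + 1}`
that is not opposite to the gate, then this edge contributes more than the gate alone forces. -/
theorem lt_closerDiff_of_gate (hG : IsHexMatching G) (hg : IsGate G X v g) {j : Fin 6}
    (hj : j = g + 2 ∨ j = g + 4) {y z : ι × Fin 6} (hy : G.Adj (v, j) y) (hyv : y.1 ≠ v)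
    (hz : G.Adj (v, j + 1) z) (hzv : z.1 ≠ v) :
    12 * (#X : ℤ) + 6 - 6 * Fintype.card ι < closerDiff G (v, j) (v, j + 1) := by
  classical
  have hjj : j ≠ j + 1 := by clear * -; revert j; decide
  rcases hj with h | h
  · have hyX : y ∉ region X v (lowerHalf j) := by
      rw [mem_region]
      rintro (hX | ⟨h1, -⟩)
      · rcases hg.exit y (v, j) hy.symm hX hg.notMem with h' | h' <;>
          simp only [Prod.mk.injEq, true_and] at h' <;>
          clear * - h h' <;> revert j g <;> decide
      · exact hyv h1
    have := le_closerDiff (insert y (region X v (lowerHalf j))) (u := (v, j)) (v := (v, j + 1))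
      (G := G) (by
        intro x hx
        rcases mem_insert.1 hx with rfl | hx
        · exact hG.dist_lt_of_outer hjj hyv hy
        · exact dist_lt_of_mem_lower hG hg (Or.inr h) hx)
    rw [card_insert_of_notMem hyX, card_region hg.notMem, card_lowerHalf, Fintype.card_prod,
      Fintype.card_fin] at this
    push_cast at this
    linarith
  · have hzX : z ∉ region X v (upperHalf j) := by
      rw [mem_region]
      rintro (hX | ⟨h1, -⟩)
      · rcases hg.exit z (v, j + 1) hz.symm hX hg.notMem with h' | h' <;>
          simp only [Prod.mk.injEq, true_and] at h' <;>
          clear * - h h' <;> revert j g <;> decide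
      · exact hzv h1
    have := le_closerDiff (insert z (region X v (upperHalf j))) (u := (v, j + 1)) (v := (v, j))
      (G := G) (by
        intro x hx
        rcases mem_insert.1 hx with rfl | hx
        · exact hG.dist_lt_of_outer hjj.symm hzv hz
        · exact dist_lt_of_mem_upper hG hg (Or.inl h) hx)
    rw [card_insert_of_notMem hzX, card_region hg.notMem, card_upperHalf, Fintype.card_prod,
      Fintype.card_fin, closerDiff_comm] at this
    push_cast at this
    linarith

theorem sum_ite_eq_four_mul (g : Fin 6) (c : ℤ) :
    ∑ i : Fin 6, (if i = g ∨ i = g + 3 then 0 else c) = 4 * c := by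
  have h : ∀ g : Fin 6, #{i : Fin 6 | ¬(i = g ∨ i = g + 3)} = 4 := by decide
  rw [Finset.sum_ite, Finset.sum_const_zero, zero_add, Finset.sum_const, h, nsmul_eq_mul]
  rfl

theorem ite_le_closerDiff_of_gate (hG : IsHexMatching G) (hg : IsGate G X v g) (i : Fin 6) :
    (if i = g ∨ i = g + 3 then 0 else 12 * (#X : ℤ) + 6 - 6 * Fintype.card ι) ≤
      closerDiff G (v, i) (v, i + 1) := by
  split_ifs with h
  · exact closerDiff_nonneg _ _ _
  · rw [not_or] at h
    exact le_closerDiff_of_gate hG hg h.1 h.2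

theorem sum_closerDiff_of_gate (hG : IsHexMatching G) (hg : IsGate G X v g) :
    4 * (12 * (#X : ℤ) + 6 - 6 * Fintype.card ι) ≤ ∑ i, closerDiff G (v, i) (v, i + 1) := by
  rw [← sum_ite_eq_four_mul g]
  exact Finset.sum_le_sum fun i _ => ite_le_closerDiff_of_gate hG hg i

theorem sum_closerDiff_of_gate_lt (hG : IsHexMatching G) (hg : IsGate G X v g) {j : Fin 6}
    (hj : j = g + 2 ∨ j = g + 4) {y z : ι × Fin 6} (hy : G.Adj (v, j) y) (hyv : y.1 ≠ v)
    (hz : G.Adj (v, j + 1) z) (hzv : z.1 ≠ v) :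
    4 * (12 * (#X : ℤ) + 6 - 6 * Fintype.card ι) < ∑ i, closerDiff G (v, i) (v, i + 1) := by
  rw [← sum_ite_eq_four_mul g]
  refine Finset.sum_lt_sum (fun i _ => ite_le_closerDiff_of_gate hG hg i) ⟨j, mem_univ j, ?_⟩
  rw [if_neg]
  · exact lt_closerDiff_of_gate hG hg hj hy hyv hz hzv
  · clear * - hj; revert j g; decide

end HexMatching

/-! ### Rooted trees of hexagons -/

/-- Tree-like phenylenes on the vertex set `ι × Fin 6`, rooted at a hexagon. Every hexagon `v`
other than the root is linked to its parent: the vertices at the positions `up v` and `up v + 1`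
of `v` are joined to those at `fst v` and `snd v` of the parent, and these two positions are
`down v` and `down v + 1`, in one of the two orders. The number of steps from `v` to the root is
`level v`. The fields `siblings` and `parent_child` say that the links at a hexagon are disjoint.
The values of `up`, `down`, `fst` and `snd` at the root have no meaning. -/
structure HexTree {ι : Type*} (G : SimpleGraph (ι × Fin 6)) where
  root : ι
  parent : ι → ι
  level : ι → ℕ
  up : ι → Fin 6
  down : ι → Fin 6
  fst : ι → Fin 6
  snd : ι → Fin 6
  parent_root : parent root = root
  level_root : level root = 0
  level_parent : ∀ v, v ≠ root → level v = level (parent v) + 1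
  ports : ∀ v, v ≠ root →
    (fst v = down v ∧ snd v = down v + 1) ∨ (fst v = down v + 1 ∧ snd v = down v)
  adj_same : ∀ v i j, G.Adj (v, i) (v, j) ↔ j = i + 1 ∨ i = j + 1
  adj_parent : ∀ v, v ≠ root → ∀ i j, G.Adj (v, i) (parent v, j) ↔
    (i = up v ∧ j = fst v) ∨ (i = up v + 1 ∧ j = snd v)
  eq_parent : ∀ v w i j, v ≠ w → G.Adj (v, i) (w, j) →
    (v ≠ root ∧ w = parent v) ∨ (w ≠ root ∧ v = parent w)
  siblings : ∀ v w, v ≠ root → w ≠ root → v ≠ w → parent v = parent w →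
    down w ≠ down v ∧ down w ≠ down v + 1 ∧ down v ≠ down w + 1
  parent_child : ∀ v w, v ≠ root → w ≠ root → parent w = v →
    down w ≠ up v ∧ down w ≠ up v + 1 ∧ up v ≠ down w + 1

theorem card_product_univ_six {ι : Type*} (X : Finset ι) : #(X ×ˢ (univ : Finset (Fin 6))) = 6 * #X := by
  rw [card_product, card_univ, Fintype.card_fin, mul_comm]

namespace HexTree

variable {ι : Type*} {G : SimpleGraph (ι × Fin 6)} (T : HexTree G)

theorem parent_ne {v : ι} (hv : v ≠ T.root) : T.parent v ≠ v := fun h => by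
  have := T.level_parent v hv
  rw [h] at this
  omega

theorem level_pos {v : ι} (hv : v ≠ T.root) : 1 ≤ T.level v := by
  rw [T.level_parent v hv]
  omega

theorem level_eq_zero_iff {v : ι} : T.level v = 0 ↔ v = T.root := by
  refine ⟨fun h => ?_, fun h => h ▸ T.level_root⟩
  by_contra hv
  have := T.level_parent v hv
  omega

theorem fst_ne_snd {v : ι} (hv : v ≠ T.root) : T.fst v ≠ T.snd v := by
  have h := T.ports v hv
  generalize T.fst v = a at *
  generalize T.snd v = b at *
  generalize T.down v = c at *
  clear * - h
  revert a b c; decide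

theorem adj_fst {v : ι} (hv : v ≠ T.root) : G.Adj (v, T.up v) (T.parent v, T.fst v) :=
  (T.adj_parent v hv _ _).2 (Or.inl ⟨rfl, rfl⟩)

theorem adj_snd {v : ι} (hv : v ≠ T.root) : G.Adj (v, T.up v + 1) (T.parent v, T.snd v) :=
  (T.adj_parent v hv _ _).2 (Or.inr ⟨rfl, rfl⟩)

/-- The positions `down v` and `down v + 1` of the parent have neighbours in `v`. -/
theorem exists_adj_down {v : ι} (hv : v ≠ T.root) {j : Fin 6}
    (hj : j = T.down v ∨ j = T.down v + 1) : ∃ i, G.Adj (T.parent v, j) (v, i) := by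
  rcases T.ports v hv with ⟨h1, h2⟩ | ⟨h1, h2⟩ <;> rcases hj with rfl | rfl
  · exact ⟨_, h1 ▸ (T.adj_fst hv).symm⟩
  · exact ⟨_, h2 ▸ (T.adj_snd hv).symm⟩
  · exact ⟨_, h2 ▸ (T.adj_snd hv).symm⟩
  · exact ⟨_, h1 ▸ (T.adj_fst hv).symm⟩

theorem eq_down_of_adj {v : ι} (hv : v ≠ T.root) {i j : Fin 6} (h : G.Adj (v, i) (T.parent v, j)) :
    j = T.down v ∨ j = T.down v + 1 := by
  have h1 := (T.adj_parent v hv i j).1 h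
  have h2 := T.ports v hv
  generalize T.fst v = a at *
  generalize T.snd v = b at *
  rcases h1 with h1 | h1 <;> rcases h2 with h2 | h2 <;> simp_all

/-- Induction from the root along the parent function. -/
theorem induction {P : ι → Prop} (root : P T.root)
    (step : ∀ v, v ≠ T.root → P (T.parent v) → P v) (v : ι) : P v := by
  induction hn : T.level v generalizing v with
  | zero => exact (T.level_eq_zero_iff.1 hn) ▸ root
  | succ n ih =>
    have hv : v ≠ T.root := fun h => by rw [h, T.level_root] at hn; omega
    have := T.level_parent v hv
    exact step v hv (ih _ (by omega))

theorem connected (T : HexTree G) : G.Connected := by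
  have h1 : ∀ v i, G.Reachable (v, 0) (v, i) := by
    intro v
    have hs : ∀ i : Fin 6, G.Reachable (v, i) (v, i + 1) :=
      fun i => ((T.adj_same v _ _).2 (Or.inl rfl)).reachable
    intro i
    induction i using Fin.induction with
    | zero => exact SimpleGraph.Reachable.refl _
    | succ i ih =>
      have := hs i.castSucc
      rw [Fin.coeSucc_eq_succ] at this
      exact ih.trans this
  have h2 : ∀ v, G.Reachable (T.root, 0) (v, 0) := by
    intro v
    induction v using T.induction with
    | root => exact SimpleGraph.Reachable.refl _
    | step v hv ih =>
      exact ih.trans ((h1 _ _).trans ((T.adj_fst hv).symm.reachable.trans (h1 _ _).symm))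
  have : Nonempty (ι × Fin 6) := ⟨(T.root, 0)⟩
  refine SimpleGraph.Connected.mk fun x y => ?_
  exact ((h2 x.1).trans (h1 x.1 x.2)).symm.trans ((h2 y.1).trans (h1 y.1 y.2))

theorem isHexMatching (T : HexTree G) : IsHexMatching G where
  connected := T.connected
  adj_same := T.adj_same
  unique := by
    rintro ⟨v, i⟩ ⟨w, j⟩ ⟨w', j'⟩ h h' (hvw : v ≠ w) (hvw' : v ≠ w')
    rcases T.eq_parent v w i j hvw h with ⟨h1, rfl⟩ | ⟨h1, rfl⟩ <;>
      rcases T.eq_parent _ w' i j' hvw' h' with ⟨h2, h3⟩ | ⟨h2, h3⟩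
    · subst h3
      have e1 := (T.adj_parent v h1 _ _).1 h
      have e2 := (T.adj_parent v h1 _ _).1 h'
      congr 1
      clear * - e1 e2
      generalize T.up v = a at *
      generalize T.fst v = b at *
      generalize T.snd v = c at *
      revert i; grind
    · subst h3
      have e1 := (T.adj_parent _ h1 _ _).1 h
      have e2 := T.eq_down_of_adj h2 h'.symm
      have e3 := T.parent_child _ _ h1 h2 rfl
      grind
    · subst h3
      have e1 := (T.adj_parent _ h2 _ _).1 h'
      have e2 := T.eq_down_of_adj h1 h.symm
      have e3 := T.parent_child _ _ h2 h1 rfl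
      grind
    · by_cases hww : w = w'
      · subst hww
        have e1 := (T.adj_parent w h1 _ _).1 h.symm
        have e2 := (T.adj_parent w h1 _ _).1 h'.symm
        have e3 := T.fst_ne_snd h1
        grind
      · have e1 := T.eq_down_of_adj h1 h.symm
        rw [h3] at h'
        have e2 := T.eq_down_of_adj h2 h'.symm
        have e3 := T.siblings w w' h1 h2 hww h3
        exfalso
        grind

/-! ### Subtrees -/

/-- `u` lies in the subtree of `v`: some iterated parent of `u` is `v`. -/
def Below (v u : ι) : Prop := ∃ n, T.parent^[n] u = v

theorem below_refl (v : ι) : T.Below v v := ⟨0, rfl⟩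

theorem iterate_parent_root (n : ℕ) : T.parent^[n] T.root = T.root :=
  Function.iterate_fixed T.parent_root n

theorem below_root_iff {v : ι} : T.Below v T.root ↔ v = T.root := by
  constructor
  · rintro ⟨n, hn⟩
    rw [← hn, T.iterate_parent_root]
  · rintro rfl
    exact T.below_refl _

theorem below_iff {v u : ι} (h : u ≠ v) : T.Below v u ↔ T.Below v (T.parent u) := by
  constructor
  · rintro ⟨n, hn⟩
    cases n with
    | zero => exact absurd hn h
    | succ n => exact ⟨n, hn⟩
  · rintro ⟨n, hn⟩
    exact ⟨n + 1, hn⟩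

theorem level_le_of_below {v u : ι} (h : T.Below v u) : T.level v ≤ T.level u := by
  induction u using T.induction with
  | root => rw [T.below_root_iff.1 h]
  | step u hu ih =>
    by_cases huv : u = v
    · rw [huv]
    · have := ih ((T.below_iff huv).1 h)
      have := T.level_parent u hu
      omega

theorem not_below_parent {v : ι} (hv : v ≠ T.root) : ¬T.Below v (T.parent v) := fun h => by
  have := T.level_le_of_below h
  have := T.level_parent v hv
  omega

open Classical in
/-- The hexagons of the subtree of `v`. -/
noncomputable def sub [Fintype ι] (v : ι) : Finset ι := {u | T.Below v u}

theorem mem_sub [Fintype ι] {u v : ι} : u ∈ T.sub v ↔ T.Below v u := by simp [sub]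

/-- Only the link between `v` and its parent leaves the subtree of `v`. -/
theorem exit_sub [Fintype ι] {v : ι} (hv : v ≠ T.root) {x y : ι × Fin 6} (h : G.Adj x y)
    (hx : x.1 ∈ T.sub v) (hy : y.1 ∉ T.sub v) :
    (x = (v, T.up v) ∧ y = (T.parent v, T.fst v)) ∨
      (x = (v, T.up v + 1) ∧ y = (T.parent v, T.snd v)) := by
  obtain ⟨a, i⟩ := x
  obtain ⟨b, j⟩ := y
  rw [mem_sub] at hx hy
  have hab : a ≠ b := fun e => hy (e ▸ hx)
  rcases T.eq_parent a b i j hab h with ⟨h1, h2⟩ | ⟨h1, h2⟩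
  · have hav : a = v := by
      by_contra hne
      exact hy (h2 ▸ (T.below_iff hne).1 hx)
    subst hav
    rw [h2] at h ⊢
    rcases (T.adj_parent a h1 _ _).1 h with ⟨rfl, rfl⟩ | ⟨rfl, rfl⟩ <;> simp
  · have hbv : b ≠ v := fun e => hy (e ▸ T.below_refl v)
    exact absurd ((T.below_iff hbv).2 (h2 ▸ hx)) hy

variable [Fintype ι]

theorem isGate_up [DecidableEq ι] {v : ι} (hv : v ≠ T.root) :
    IsGate G (T.sub v)ᶜ v (T.up v) where
  notMem := by
    rw [mem_compl, not_not, mem_sub]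
    exact T.below_refl v
  exit := by
    intro y z hyz hy hz
    rw [mem_compl] at hy hz
    rw [not_not] at hz
    rcases T.exit_sub hv hyz.symm hz hy with ⟨h, -⟩ | ⟨h, -⟩ <;> simp [h]

theorem isGate_down {v : ι} (hv : v ≠ T.root) :
    IsGate G (T.sub v) (T.parent v) (T.down v) where
  notMem := by
    rw [mem_sub]
    exact T.not_below_parent hv
  exit := by
    intro y z hyz hy hz
    rcases T.exit_sub hv hyz hy hz with ⟨-, h⟩ | ⟨-, h⟩ <;> rw [h] <;>
      rcases T.ports v hv with h' | h' <;> simp [h']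

theorem dist_parent_lt {v : ι} (hv : v ≠ T.root) {x : ι × Fin 6} (hx : x.1 ∉ T.sub v) :
    G.dist x (T.parent v, T.fst v) < G.dist x (v, T.up v) ∧
    G.dist x (T.parent v, T.snd v) < G.dist x (v, T.up v + 1) := by
  have hadj : G.Adj (T.parent v, T.fst v) (T.parent v, T.snd v) := by
    rw [T.adj_same]
    rcases T.ports v hv with h | h <;> simp [h]
  have hv' : v ∈ T.sub v := T.mem_sub.2 (T.below_refl v)
  have hne : T.up v ≠ T.up v + 1 := by
    generalize T.up v = a; revert a; decide
  constructor
  · refine dist_lt_dist_of_rungs T.connected (X := {x | x.1 ∉ T.sub v})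
      (b := (v, T.up v + 1)) (b' := (T.parent v, T.snd v)) ?_ (by simpa using hv') ?_ hadj hx
    · intro y hy z hz hyz
      have := T.exit_sub hv hyz.symm (by simpa using hz) hy
      tauto
    · simp [hne]
  · refine dist_lt_dist_of_rungs T.connected (X := {x | x.1 ∉ T.sub v})
      (b := (v, T.up v)) (b' := (T.parent v, T.fst v)) ?_ (by simpa using hv') ?_ hadj.symm hx
    · intro y hy z hz hyz
      have := T.exit_sub hv hyz.symm (by simpa using hz) hy
      tauto
    · simp [hne.symm]

theorem dist_up_lt {v : ι} (hv : v ≠ T.root) {x : ι × Fin 6} (hx : x.1 ∈ T.sub v) :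
    G.dist x (v, T.up v) < G.dist x (T.parent v, T.fst v) ∧
    G.dist x (v, T.up v + 1) < G.dist x (T.parent v, T.snd v) := by
  have hadj : G.Adj (v, T.up v) (v, T.up v + 1) := by simp [T.adj_same]
  have hp : T.parent v ∉ T.sub v := fun h => T.not_below_parent hv (T.mem_sub.1 h)
  have hne := T.fst_ne_snd hv
  constructor
  · refine dist_lt_dist_of_rungs T.connected (X := {x | x.1 ∈ T.sub v})
      (b' := (v, T.up v + 1)) (b := (T.parent v, T.snd v)) ?_ (by simpa using hp) ?_ hadj hx
    · intro y hy z hz hyz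
      exact T.exit_sub hv hyz hy hz
    · simp [hne]
  · refine dist_lt_dist_of_rungs T.connected (X := {x | x.1 ∈ T.sub v})
      (b' := (v, T.up v)) (b := (T.parent v, T.fst v)) ?_ (by simpa using hp) ?_ hadj.symm hx
    · intro y hy z hz hyz
      exact (T.exit_sub hv hyz hy hz).symm
    · simp [hne.symm]

theorem card_sub_add_compl [DecidableEq ι] (v : ι) :
    #(T.sub v) + #(T.sub v)ᶜ = Fintype.card ι := Finset.card_add_card_compl _

/-- The two rungs of a link separate the subtree of `v` from the other hexagons. -/
theorem closerDiff_rung {v : ι} (hv : v ≠ T.root) :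
    closerDiff G (v, T.up v) (T.parent v, T.fst v) =
      6 * |(Fintype.card ι : ℤ) - 2 * #(T.sub v)| ∧
    closerDiff G (v, T.up v + 1) (T.parent v, T.snd v) =
      6 * |(Fintype.card ι : ℤ) - 2 * #(T.sub v)| := by
  classical
  have hc := T.card_sub_add_compl v
  have habs : |(6 * #(T.sub v) : ℤ) - 6 * #(T.sub v)ᶜ| =
      6 * |(Fintype.card ι : ℤ) - 2 * #(T.sub v)| := by
    rw [← abs_neg, ← hc]
    push_cast
    rw [show -(6 * (#(T.sub v) : ℤ) - 6 * #(T.sub v)ᶜ) =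
      6 * (#(T.sub v) + #(T.sub v)ᶜ - 2 * #(T.sub v)) by ring, abs_mul]
    rfl
  have hcard : #(T.sub v ×ˢ (univ : Finset (Fin 6))) + #((T.sub v)ᶜ ×ˢ (univ : Finset (Fin 6))) =
      Fintype.card (ι × Fin 6) := by
    rw [card_product_univ_six, card_product_univ_six, Fintype.card_prod, Fintype.card_fin]
    omega
  constructor
  all_goals
    rw [closerDiff_eq (T.sub v ×ˢ univ) ((T.sub v)ᶜ ×ˢ univ) _ _ hcard, card_product_univ_six,
      card_product_univ_six]
    · push_cast
      exact habs
    · intro x hx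
      simp only [mem_product, mem_univ, and_true] at hx
      first | exact (T.dist_up_lt hv hx).1 | exact (T.dist_up_lt hv hx).2
    · intro x hx
      simp only [mem_product, mem_univ, and_true, mem_compl] at hx
      first | exact (T.dist_parent_lt hv hx).1 | exact (T.dist_parent_lt hv hx).2

end HexTree

/-! ### The sum of the levels in a tree -/

section LevelSum

variable {ι : Type*}

/-- If the positive values of `f` on `S` have no gaps, the sum of these values is at most
`1 + 2 + ⋯ + #S`, and it is smaller if a value is repeated. -/
theorem two_mul_sum_level_le (f : ι → ℕ) (S : Finset ι) (h1 : ∀ u ∈ S, 1 ≤ f u)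
    (h2 : ∀ u ∈ S, 2 ≤ f u → ∃ u' ∈ S, f u' + 1 = f u) :
    2 * ∑ u ∈ S, f u ≤ #S * (#S + 1) ∧
      (¬Set.InjOn f S → 2 * ∑ u ∈ S, f u + 2 ≤ #S * (#S + 1)) := by
  classical
  induction hn : #S generalizing S with
  | zero =>
    rw [card_eq_zero] at hn
    subst hn
    simp
  | succ n ih =>
    have hne : S.Nonempty := by
      rw [← card_pos]
      omega
    obtain ⟨u, hu, hmax⟩ := exists_max_image S f hne
    have hsub : Icc 1 (f u) ⊆ S.image f := by
      have key : ∀ d, d < f u → f u - d ∈ S.image f := by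
        intro d hd
        induction d with
        | zero => exact mem_image_of_mem f hu
        | succ d ih' =>
          obtain ⟨a, ha, hfa⟩ := mem_image.1 (ih' (by omega))
          obtain ⟨b, hb, hfb⟩ := h2 a ha (by omega)
          exact mem_image.2 ⟨b, hb, by omega⟩
      intro t ht
      rw [mem_Icc] at ht
      have := key (f u - t) (by omega)
      rwa [Nat.sub_sub_self ht.2] at this
    have hcard := card_le_card hsub
    rw [Nat.card_Icc, Nat.add_sub_cancel] at hcard
    have hle := (card_image_le (s := S) (f := f))
    have hS : #(S.erase u) = n := by rw [card_erase_of_mem hu, hn, Nat.add_sub_cancel]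
    obtain ⟨ih1, -⟩ := ih (S.erase u) (fun a ha => h1 a (mem_of_mem_erase ha)) (by
      intro a ha hfa
      obtain ⟨b, hb, hfb⟩ := h2 a (mem_of_mem_erase ha) hfa
      refine ⟨b, mem_erase.2 ⟨?_, hb⟩, hfb⟩
      rintro rfl
      have := hmax a (mem_of_mem_erase ha)
      omega) hS
    have hsum := add_sum_erase S f hu
    refine ⟨by nlinarith, fun hinj => ?_⟩
    have hlt : #(S.image f) < #S := lt_of_le_of_ne hle fun h => hinj (card_image_iff.1 h)
    nlinarith

end LevelSum

namespace HexTree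

variable {ι : Type*} {G : SimpleGraph (ι × Fin 6)} (T : HexTree G)

/-- Two edges from a hexagon to its parent are equal only if they start at the same vertex. -/
theorem eq_of_mk_parent_eq {v w : ι} (hv : v ≠ T.root) (hw : w ≠ T.root) {i i' j j' : Fin 6}
    (h : s((v, i), (T.parent v, j)) = s((w, i'), (T.parent w, j'))) : v = w ∧ i = i' := by
  rw [Sym2.eq_iff] at h
  simp only [Prod.mk.injEq] at h
  rcases h with h | h
  · exact h.1
  · have h1 := T.level_parent v hv
    have h2 := T.level_parent w hw
    rw [h.2.1] at h1
    rw [← h.1.1] at h2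
    omega

variable [Fintype ι]

/-- The Mostar index as a sum over the edges of the hexagons and the rungs of the
quadrilaterals. -/
theorem mostarIndex_eq [DecidableEq ι] :
    mostarIndex G = ∑ v, ∑ i, closerDiff G (v, i) (v, i + 1) +
      ∑ v ∈ univ.erase T.root, 12 * |(Fintype.card ι : ℤ) - 2 * #(T.sub v)| := by
  classical
  set A : Finset (Sym2 (ι × Fin 6)) :=
    (univ : Finset (ι × Fin 6)).image fun p => s((p.1, p.2), (p.1, p.2 + 1)) with hA
  set B : Finset (Sym2 (ι × Fin 6)) :=
    (univ.erase T.root).image fun v => s((v, T.up v), (T.parent v, T.fst v)) with hB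
  set C : Finset (Sym2 (ι × Fin 6)) :=
    (univ.erase T.root).image fun v => s((v, T.up v + 1), (T.parent v, T.snd v)) with hC
  have hE : G.edgeFinset = A ∪ (B ∪ C) := by
    ext e
    induction e with
    | _ x y =>
      obtain ⟨v, i⟩ := x
      obtain ⟨w, j⟩ := y
      rw [SimpleGraph.mem_edgeFinset, SimpleGraph.mem_edgeSet, mem_union, mem_union, hA, hB, hC]
      simp only [mem_image, mem_univ, true_and, mem_erase, and_true]
      constructor
      · intro h
        by_cases hvw : v = w
        · subst hvw
          left
          rcases (T.adj_same v i j).1 h with rfl | rfl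
          · exact ⟨(v, i), rfl⟩
          · exact ⟨(v, j), Sym2.eq_swap⟩
        · right
          rcases T.eq_parent v w i j hvw h with ⟨hv, rfl⟩ | ⟨hw, rfl⟩
          · rcases (T.adj_parent v hv i j).1 h with ⟨rfl, rfl⟩ | ⟨rfl, rfl⟩
            · exact Or.inl ⟨v, hv, rfl⟩
            · exact Or.inr ⟨v, hv, rfl⟩
          · rcases (T.adj_parent w hw j i).1 h.symm with ⟨rfl, rfl⟩ | ⟨rfl, rfl⟩
            · exact Or.inl ⟨w, hw, Sym2.eq_swap⟩
            · exact Or.inr ⟨w, hw, Sym2.eq_swap⟩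
      · rw [← SimpleGraph.mem_edgeSet]
        rintro (⟨p, hp⟩ | ⟨u, hu, hp⟩ | ⟨u, hu, hp⟩)
        · rw [← hp, SimpleGraph.mem_edgeSet, T.adj_same]
          exact Or.inl rfl
        · rw [← hp, SimpleGraph.mem_edgeSet]
          exact T.adj_fst hu
        · rw [← hp, SimpleGraph.mem_edgeSet]
          exact T.adj_snd hu
  have hA_same : ∀ v i w j, s((v, i), (w, j)) ∈ A → v = w := by
    intro v i w j h
    obtain ⟨p, -, hp⟩ := mem_image.1 h
    rw [Sym2.eq_iff] at hp
    simp only [Prod.mk.injEq] at hp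
    rcases hp with hp | hp
    · exact hp.1.1.symm.trans hp.2.1
    · exact hp.2.1.symm.trans hp.1.1
  have hdisj1 : Disjoint A (B ∪ C) := by
    rw [Finset.disjoint_left]
    intro e he he'
    rcases mem_union.1 he' with h | h <;> obtain ⟨v, hv, rfl⟩ := mem_image.1 h <;>
      exact T.parent_ne (mem_erase.1 hv).1 (hA_same _ _ _ _ he).symm
  have hdisj2 : Disjoint B C := by
    rw [Finset.disjoint_left]
    intro e he he'
    obtain ⟨v, hv, rfl⟩ := mem_image.1 he
    obtain ⟨w, hw, h⟩ := mem_image.1 he'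
    obtain ⟨rfl, h2⟩ := T.eq_of_mk_parent_eq (mem_erase.1 hw).1 (mem_erase.1 hv).1 h
    generalize T.up w = a at h2
    clear * - h2
    revert a; decide
  have hinjA : Set.InjOn (fun p : ι × Fin 6 => s((p.1, p.2), (p.1, p.2 + 1)))
      (univ : Finset (ι × Fin 6)) := by
    rintro ⟨v, i⟩ - ⟨w, j⟩ - h
    have h' := Sym2.eq_iff.1 h
    simp only [Prod.mk.injEq] at h' ⊢
    rcases h' with h' | h'
    · exact h'.1
    · exfalso
      obtain ⟨⟨-, h1⟩, -, h2⟩ := h'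
      clear * - h1 h2
      revert i j; decide
  have hinjB : Set.InjOn (fun v => s((v, T.up v), (T.parent v, T.fst v)))
      (univ.erase T.root : Finset ι) := by
    intro v hv w hw h
    exact (T.eq_of_mk_parent_eq (mem_erase.1 hv).1 (mem_erase.1 hw).1 h).1
  have hinjC : Set.InjOn (fun v => s((v, T.up v + 1), (T.parent v, T.snd v)))
      (univ.erase T.root : Finset ι) := by
    intro v hv w hw h
    exact (T.eq_of_mk_parent_eq (mem_erase.1 hv).1 (mem_erase.1 hw).1 h).1
  have hsum : mostarIndex G = ∑ e ∈ A ∪ (B ∪ C), Sym2.lift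
      ⟨fun u v => closerDiff G u v, closerDiff_comm G⟩ e := by
    rw [← hE]
    unfold mostarIndex
    congr!
  rw [hsum, sum_union hdisj1, sum_union hdisj2, sum_image hinjA, sum_image hinjB,
    sum_image hinjC, ← Finset.sum_add_distrib, ← Finset.univ_product_univ, Finset.sum_product]
  congr 1
  refine Finset.sum_congr rfl fun v hv => ?_
  have := T.closerDiff_rung (mem_erase.1 hv).1
  simp only [Sym2.lift_mk, this.1, this.2]
  ring

/-- The sizes of the proper subtrees add up to the sum of the levels. -/
theorem sum_card_sub [DecidableEq ι] :
    ∑ v ∈ univ.erase T.root, #(T.sub v) = ∑ u, T.level u := by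
  classical
  have h : ∀ u, #{v ∈ univ.erase T.root | T.Below v u} = T.level u := by
    intro u
    induction u using T.induction with
    | root =>
      rw [T.level_root, card_eq_zero, filter_eq_empty_iff]
      intro v hv h
      exact (mem_erase.1 hv).1 (T.below_root_iff.1 h)
    | step u hu ih =>
      have : {v ∈ univ.erase T.root | T.Below v u} =
          insert u {v ∈ univ.erase T.root | T.Below v (T.parent u)} := by
        ext v
        simp only [mem_filter, mem_insert, mem_erase, mem_univ, and_true]
        by_cases huv : u = v
        · subst huv
          simp [hu, T.below_refl]
        · rw [T.below_iff huv]
          simp [Ne.symm huv]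
      rw [this, card_insert_of_notMem, ih, ← T.level_parent u hu]
      simp [T.not_below_parent hu]
  simp_rw [← h]
  exact Finset.sum_card_bipartiteAbove_eq_sum_card_bipartiteBelow (fun v u => T.Below v u)
    (s := univ.erase T.root) (t := univ)

/-- The children of the root. -/
def children [DecidableEq ι] : Finset ι := {c ∈ univ.erase T.root | T.parent c = T.root}

theorem mem_children [DecidableEq ι] {c : ι} :
    c ∈ T.children ↔ c ≠ T.root ∧ T.parent c = T.root := by simp [children]

theorem level_child [DecidableEq ι] {c : ι} (hc : c ∈ T.children) : T.level c = 1 := by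
  rw [mem_children] at hc
  rw [T.level_parent c hc.1, hc.2, T.level_root]

theorem exists_child [DecidableEq ι] {u : ι} (hu : u ≠ T.root) :
    ∃ c ∈ T.children, u ∈ T.sub c := by
  induction u using T.induction with
  | root => exact absurd rfl hu
  | step u hu' ih =>
    by_cases h : T.parent u = T.root
    · exact ⟨u, T.mem_children.2 ⟨hu', h⟩, T.mem_sub.2 (T.below_refl u)⟩
    · obtain ⟨c, hc, h'⟩ := ih h
      refine ⟨c, hc, ?_⟩
      obtain ⟨n, hn⟩ := T.mem_sub.1 h'
      exact T.mem_sub.2 ⟨n + 1, hn⟩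

theorem child_unique [DecidableEq ι] {u c c' : ι} (hc : c ∈ T.children) (hc' : c' ∈ T.children)
    (h : u ∈ T.sub c) (h' : u ∈ T.sub c') : c = c' := by
  rw [mem_sub] at h h'
  induction u using T.induction with
  | root => exact (T.below_root_iff.1 h).trans (T.below_root_iff.1 h').symm
  | step u hu ih =>
    by_cases h1 : u = c
    · by_cases h2 : u = c'
      · exact h1.symm.trans h2
      · rw [T.below_iff h2, h1, (T.mem_children.1 hc).2, T.below_root_iff] at h'
        exact absurd h' (T.mem_children.1 hc').1
    · by_cases h2 : u = c'
      · rw [T.below_iff h1, h2, (T.mem_children.1 hc').2, T.below_root_iff] at h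
        exact absurd h (T.mem_children.1 hc).1
      · exact ih ((T.below_iff h1).1 h) ((T.below_iff h2).1 h')

theorem root_notMem_sub {c : ι} (hc : c ≠ T.root) : T.root ∉ T.sub c := fun h =>
  hc (T.below_root_iff.1 (T.mem_sub.1 h))

theorem erase_root_eq_biUnion [DecidableEq ι] :
    univ.erase T.root = T.children.biUnion T.sub := by
  ext u
  rw [mem_biUnion]
  constructor
  · intro hu
    exact T.exists_child (mem_erase.1 hu).1
  · rintro ⟨c, hc, hu⟩
    refine mem_erase.2 ⟨?_, mem_univ u⟩
    rintro rfl
    exact T.root_notMem_sub (T.mem_children.1 hc).1 hu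

theorem pairwiseDisjoint_sub [DecidableEq ι] :
    (T.children : Set ι).PairwiseDisjoint T.sub := by
  intro c hc c' hc' hne
  rw [Function.onFun, Finset.disjoint_left]
  intro u hu hu'
  exact hne (T.child_unique hc hc' hu hu')

theorem card_erase_root [DecidableEq ι] : #(univ.erase T.root) + 1 = Fintype.card ι := by
  rw [card_erase_add_one (mem_univ _), card_univ]

theorem sum_level_eq_sum_erase [DecidableEq ι] :
    ∑ u, T.level u = ∑ u ∈ univ.erase T.root, T.level u := by
  rw [← add_sum_erase univ T.level (mem_univ T.root), T.level_root, zero_add]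

theorem two_mul_sum_level_sub_le [DecidableEq ι] {c : ι} (hc : c ∈ T.children) :
    2 * ∑ u ∈ T.sub c, T.level u ≤ #(T.sub c) * (#(T.sub c) + 1) := by
  have hc0 := (T.mem_children.1 hc).1
  refine (two_mul_sum_level_le T.level (T.sub c) ?_ ?_).1
  · intro u hu
    apply T.level_pos
    rintro rfl
    exact T.root_notMem_sub hc0 hu
  · intro u hu h2
    have hu0 : u ≠ T.root := by
      rintro rfl
      exact T.root_notMem_sub hc0 hu
    refine ⟨T.parent u, ?_, (T.level_parent u hu0).symm⟩
    rw [mem_sub] at hu ⊢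
    refine (T.below_iff ?_).1 hu
    rintro rfl
    rw [T.level_child hc] at h2
    omega

/-- The level sum, estimated in every branch at the root, in terms of the largest branch. -/
theorem two_mul_sum_level_le_of_forall [DecidableEq ι] {b : ℕ}
    (hb : ∀ c ∈ T.children, #(T.sub c) ≤ b) :
    2 * ∑ u, T.level u ≤ #(univ.erase T.root) * (b + 1) := by
  rw [T.sum_level_eq_sum_erase, T.erase_root_eq_biUnion, sum_biUnion T.pairwiseDisjoint_sub,
    card_biUnion fun c hc c' hc' h => T.pairwiseDisjoint_sub hc hc' h, mul_sum, sum_mul]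
  refine Finset.sum_le_sum fun c hc => (T.two_mul_sum_level_sub_le hc).trans ?_
  exact Nat.mul_le_mul_left _ (Nat.succ_le_succ (hb c hc))

/-- The level sum, estimated in one branch at the root and outside this branch. -/
theorem two_mul_sum_level_le_of_child [DecidableEq ι] {c : ι} (hc : c ∈ T.children) {b r : ℕ}
    (hb : #(T.sub c) = b) (hr : b + r + 1 = Fintype.card ι) :
    2 * ∑ u, T.level u ≤ b * (b + 1) + r * (r + 1) ∧
      ((∃ c₁ ∈ T.children, ∃ c₂ ∈ T.children, c₁ ≠ c₂ ∧ c₁ ≠ c ∧ c₂ ≠ c) →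
        2 * ∑ u, T.level u < b * (b + 1) + r * (r + 1)) := by
  have hc0 := (T.mem_children.1 hc).1
  have hsub : T.sub c ⊆ univ.erase T.root := by
    intro u hu
    refine mem_erase.2 ⟨?_, mem_univ u⟩
    rintro rfl
    exact T.root_notMem_sub hc0 hu
  have hcard : #(univ.erase T.root \ T.sub c) = r := by
    rw [card_sdiff_of_subset hsub, hb]
    have := T.card_erase_root
    omega
  have h1 := T.two_mul_sum_level_sub_le hc
  rw [hb] at h1
  have h2 := two_mul_sum_level_le T.level (univ.erase T.root \ T.sub c) (by
      intro u hu
      exact T.level_pos (mem_erase.1 (mem_sdiff.1 hu).1).1) (by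
      intro u hu hlev
      have hu0 := (mem_erase.1 (mem_sdiff.1 hu).1).1
      have hlp := T.level_parent u hu0
      refine ⟨T.parent u, mem_sdiff.2 ⟨mem_erase.2 ⟨?_, mem_univ _⟩, ?_⟩, hlp.symm⟩
      · intro h
        rw [h, T.level_root] at hlp
        omega
      · intro h
        refine (mem_sdiff.1 hu).2 ?_
        obtain ⟨n, hn⟩ := T.mem_sub.1 h
        exact T.mem_sub.2 ⟨n + 1, hn⟩)
  rw [hcard] at h2
  have h3 := sum_sdiff hsub (f := T.level)
  rw [← T.sum_level_eq_sum_erase] at h3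
  refine ⟨by omega, ?_⟩
  rintro ⟨c₁, hc₁, c₂, hc₂, hne, hne₁, hne₂⟩
  have hmem : ∀ c' ∈ T.children, c' ≠ c → c' ∈ univ.erase T.root \ T.sub c := by
    intro c' hc' h
    refine mem_sdiff.2 ⟨mem_erase.2 ⟨(T.mem_children.1 hc').1, mem_univ _⟩, fun h' => ?_⟩
    exact h (T.child_unique hc' hc (T.mem_sub.2 (T.below_refl c')) h')
  have := h2.2 fun hinj => hne (hinj (hmem c₁ hc₁ hne₁) (hmem c₂ hc₂ hne₂)
    ((T.level_child hc₁).trans (T.level_child hc₂).symm))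
  omega

end HexTree

/-! ### The lower bound for a balanced root -/

/-- The Mostar index of the linear phenylene chain with `h` hexagons. -/
def linearMostar (h : ℕ) : ℤ := 72 * (h / 2 : ℕ) * ((h + 1) / 2 : ℕ) - 24 * (h / 2 : ℕ)

theorem linearMostar_two_mul (b : ℕ) : linearMostar (2 * b) = 72 * (b : ℤ) ^ 2 - 24 * b := by
  unfold linearMostar
  rw [show 2 * b / 2 = b by omega, show (2 * b + 1) / 2 = b by omega]
  ring

theorem linearMostar_two_mul_add_one (b : ℕ) :
    linearMostar (2 * b + 1) = 72 * (b : ℤ) ^ 2 + 48 * b := by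
  unfold linearMostar
  rw [show (2 * b + 1) / 2 = b by omega, show (2 * b + 1 + 1) / 2 = b + 1 by omega]
  push_cast
  ring

/-- The value of the lower bound for a chain that is rooted in the middle, with `b` hexagons on one
side of the root and `r` on the other. -/
theorem linearMostar_eq {H b r : ℕ} (hr : b + r + 1 = H) (h1 : 2 * b ≤ H) (h2 : H ≤ 2 * b + 1) :
    linearMostar H = 24 * (2 * (b : ℤ) - H + 1) +
      (((H : ℤ) - 1) * (36 * H + 24) - 36 * (b * (b + 1) + r * (r + 1))) := by
  rcases Nat.lt_or_ge (2 * b) H with h | h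
  · obtain rfl : r = b := by omega
    rw [show H = 2 * r + 1 by omega, linearMostar_two_mul_add_one]
    push_cast
    ring
  · obtain rfl : b = r + 1 := by omega
    rw [show H = 2 * (r + 1) by omega, linearMostar_two_mul]
    push_cast
    ring

/-- Every hexagon has a pair of opposite vertices without neighbours in other hexagons. This
means that it has at most two links, and that two links sit at opposite edges. -/
def IsStraight {ι : Type*} (G : SimpleGraph (ι × Fin 6)) : Prop :=
  ∀ v, ∃ k : Fin 6, ∀ y : ι × Fin 6, y.1 ≠ v → ¬G.Adj (v, k) y ∧ ¬G.Adj (v, k + 3) y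

namespace HexTree

variable {ι : Type*} {G : SimpleGraph (ι × Fin 6)} (T : HexTree G)

/-- A neighbour of the hexagon `v` in another hexagon belongs to the parent or to a child. -/
theorem outer_cases {v : ι} {i : Fin 6} {y : ι × Fin 6} (hy : y.1 ≠ v) (h : G.Adj (v, i) y) :
    (v ≠ T.root ∧ (i = T.up v ∨ i = T.up v + 1)) ∨
      ∃ w, w ≠ T.root ∧ T.parent w = v ∧ (i = T.down w ∨ i = T.down w + 1) := by
  obtain ⟨w, j⟩ := y
  rcases T.eq_parent v w i j (Ne.symm hy) h with ⟨hv, rfl⟩ | ⟨hw, rfl⟩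
  · refine Or.inl ⟨hv, ?_⟩
    have := (T.adj_parent v hv i j).1 h
    tauto
  · exact Or.inr ⟨w, hw, rfl, T.eq_down_of_adj hw h.symm⟩

theorem isStraight_of_down_eq (h1 : ∀ w, w ≠ T.root → T.parent w ≠ T.root →
      T.down w = T.up (T.parent w) + 3)
    (h2 : ∃ k : Fin 6, ∀ c, c ≠ T.root → T.parent c = T.root →
      T.down c = k ∨ T.down c = k + 3) : IsStraight G := by
  intro v
  by_cases hv : v = T.root
  · obtain ⟨k, hk⟩ := h2
    refine ⟨k + 2, fun y hy => ⟨fun h => ?_, fun h => ?_⟩⟩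
    all_goals
      rcases T.outer_cases hy h with ⟨h', -⟩ | ⟨w, hw, hwv, hi⟩
      · exact h' hv
      · have := hk w hw (hwv.trans hv)
        generalize T.down w = a at *
        clear * - this hi
        revert k a; decide
  · refine ⟨T.up v + 2, fun y hy => ⟨fun h => ?_, fun h => ?_⟩⟩
    all_goals
      rcases T.outer_cases hy h with ⟨-, hi⟩ | ⟨w, hw, hwv, hi⟩
      · generalize T.up v = a at *
        clear * - hi
        revert a; decide
      · have := h1 w hw (by rwa [hwv])
        rw [hwv] at this
        generalize T.down w = a at *
        generalize T.up v = k at *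
        clear * - this hi
        revert k a; decide

/-- Two links at the same hexagon, one of which is at the edge `{g, g + 1}` and the other at
`{d, d + 1}`, are at edges that are opposite or of distance two. -/
theorem eq_add_two_or_four {g d : Fin 6} (h : d ≠ g ∧ d ≠ g + 1 ∧ g ≠ d + 1) (h3 : d ≠ g + 3) :
    d = g + 2 ∨ d = g + 4 := by
  revert g d; decide

variable [Fintype ι]

theorem le_sum_closerDiff {v : ι} (hv : v ≠ T.root) :
    24 * ((Fintype.card ι : ℤ) - 2 * #(T.sub v) + 1) ≤ ∑ i, closerDiff G (v, i) (v, i + 1) := by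
  classical
  have := sum_closerDiff_of_gate T.isHexMatching (T.isGate_up hv)
  have hc := T.card_sub_add_compl v
  zify at hc
  linarith

theorem lt_sum_closerDiff {w : ι} (hw : w ≠ T.root) (hv : T.parent w ≠ T.root)
    (hne : T.down w ≠ T.up (T.parent w) + 3) :
    24 * ((Fintype.card ι : ℤ) - 2 * #(T.sub (T.parent w)) + 1) <
      ∑ i, closerDiff G (T.parent w, i) (T.parent w, i + 1) := by
  classical
  obtain ⟨y, hy⟩ := T.exists_adj_down hw (Or.inl rfl)
  obtain ⟨z, hz⟩ := T.exists_adj_down hw (Or.inr rfl)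
  have := sum_closerDiff_of_gate_lt T.isHexMatching (T.isGate_up hv)
    (eq_add_two_or_four (T.parent_child _ w hv hw rfl) hne) hy (T.parent_ne hw).symm hz
    (T.parent_ne hw).symm
  have hc := T.card_sub_add_compl (T.parent w)
  zify at hc
  linarith

theorem le_sum_closerDiff_root {c : ι} (hc : c ≠ T.root) (hcp : T.parent c = T.root) :
    24 * (2 * (#(T.sub c) : ℤ) - Fintype.card ι + 1) ≤
      ∑ i, closerDiff G (T.root, i) (T.root, i + 1) := by
  have := sum_closerDiff_of_gate T.isHexMatching (T.isGate_down hc)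
  rw [hcp] at this
  linarith

theorem lt_sum_closerDiff_root {c c' : ι} (hc : c ≠ T.root) (hcp : T.parent c = T.root)
    (hc' : c' ≠ T.root) (hcp' : T.parent c' = T.root) (hne : c ≠ c')
    (hd : T.down c' ≠ T.down c + 3) :
    24 * (2 * (#(T.sub c) : ℤ) - Fintype.card ι + 1) <
      ∑ i, closerDiff G (T.root, i) (T.root, i + 1) := by
  obtain ⟨y, hy⟩ := T.exists_adj_down hc' (Or.inl rfl)
  obtain ⟨z, hz⟩ := T.exists_adj_down hc' (Or.inr rfl)
  have hg := T.isGate_down hc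
  rw [hcp] at hg
  rw [hcp'] at hy hz
  have := sum_closerDiff_of_gate_lt T.isHexMatching hg
    (eq_add_two_or_four (T.siblings c c' hc hc' hne (hcp.trans hcp'.symm)) hd) hy hc' hz hc'
  linarith

theorem sum_sizes [DecidableEq ι] :
    ∑ v ∈ univ.erase T.root, (24 * ((Fintype.card ι : ℤ) - 2 * #(T.sub v) + 1) +
        12 * ((Fintype.card ι : ℤ) - 2 * #(T.sub v))) =
      ((Fintype.card ι : ℤ) - 1) * (36 * Fintype.card ι + 24) - 72 * ∑ u, (T.level u : ℤ) := by
  have h1 : ∀ v ∈ univ.erase T.root, (24 * ((Fintype.card ι : ℤ) - 2 * #(T.sub v) + 1) +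
        12 * ((Fintype.card ι : ℤ) - 2 * #(T.sub v))) =
      (36 * (Fintype.card ι : ℤ) + 24) - 72 * #(T.sub v) := fun v _ => by ring
  rw [Finset.sum_congr rfl h1, Finset.sum_sub_distrib, Finset.sum_const, ← Finset.mul_sum,
    nsmul_eq_mul]
  have h2 := T.sum_card_sub
  have h3 := T.card_erase_root
  zify at h2 h3
  rw [h2, ← h3]
  ring

/-- Every hexagon edge and every rung is estimated from the side of its hexagon that contains the
root; the root itself is left as it is. Equality forces the links at every other hexagon to be
opposite. -/
theorem le_mostarIndex :
    (∑ i, closerDiff G (T.root, i) (T.root, i + 1) +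
      (((Fintype.card ι : ℤ) - 1) * (36 * Fintype.card ι + 24) - 72 * ∑ u, (T.level u : ℤ))
        ≤ mostarIndex G) ∧
    ((∃ w, w ≠ T.root ∧ T.parent w ≠ T.root ∧ T.down w ≠ T.up (T.parent w) + 3) →
      ∑ i, closerDiff G (T.root, i) (T.root, i + 1) +
      (((Fintype.card ι : ℤ) - 1) * (36 * Fintype.card ι + 24) - 72 * ∑ u, (T.level u : ℤ))
        < mostarIndex G) := by
  classical
  rw [T.mostarIndex_eq, ← T.sum_sizes, ← add_sum_erase univ _ (mem_univ T.root), add_assoc,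
    ← Finset.sum_add_distrib]
  have hle : ∀ v ∈ univ.erase T.root, 24 * ((Fintype.card ι : ℤ) - 2 * #(T.sub v) + 1) +
        12 * ((Fintype.card ι : ℤ) - 2 * #(T.sub v)) ≤
      ∑ i, closerDiff G (v, i) (v, i + 1) + 12 * |(Fintype.card ι : ℤ) - 2 * #(T.sub v)| := by
    intro v hv
    have h1 := T.le_sum_closerDiff (mem_erase.1 hv).1
    have h2 := le_abs_self ((Fintype.card ι : ℤ) - 2 * #(T.sub v))
    linarith
  refine ⟨by linarith [Finset.sum_le_sum hle], ?_⟩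
  rintro ⟨w, hw, hv, hne⟩
  have := Finset.sum_lt_sum hle ⟨T.parent w, mem_erase.2 ⟨hv, mem_univ _⟩, by
    have h1 := T.lt_sum_closerDiff hw hv hne
    have h2 := le_abs_self ((Fintype.card ι : ℤ) - 2 * #(T.sub (T.parent w)))
    linarith⟩
  linarith

/-- The lower bound for the Mostar index, and its equality case, if no branch at the root has more
than half of the hexagons. -/
theorem linearMostar_le_of_balanced
    (hbal : ∀ c, c ≠ T.root → T.parent c = T.root → 2 * #(T.sub c) ≤ Fintype.card ι) :
    linearMostar (Fintype.card ι) ≤ mostarIndex G ∧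
      (mostarIndex G = linearMostar (Fintype.card ι) → IsStraight G) := by
  classical
  obtain ⟨hM, hMlt⟩ := T.le_mostarIndex
  set R := ∑ i, closerDiff G (T.root, i) (T.root, i + 1) with hR
  have hR0 : 0 ≤ R := Finset.sum_nonneg fun i _ => closerDiff_nonneg _ _ _
  have hΛ : ∑ u, (T.level u : ℤ) = ((∑ u, T.level u : ℕ) : ℤ) := by push_cast; rfl
  rw [hΛ] at hM hMlt
  set Λ := ∑ u, T.level u with hΛdef
  have hcard := T.card_erase_root
  set H := Fintype.card ι with hH
  have hstep : ∀ M : ℤ, M ≤ R + (((H : ℤ) - 1) * (36 * H + 24) - 72 * (Λ : ℤ)) →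
      mostarIndex G = M → ∀ w, w ≠ T.root → T.parent w ≠ T.root →
        T.down w = T.up (T.parent w) + 3 := by
    intro M hle heq w hw hv
    by_contra hne
    have := hMlt ⟨w, hw, hv, hne⟩
    linarith
  by_cases hch : T.children = ∅
  · have hempty : univ.erase T.root = ∅ := by rw [T.erase_root_eq_biUnion, hch, biUnion_empty]
    have hH1 : H = 1 := by rw [hempty, card_empty] at hcard; omega
    have hΛ0 : Λ = 0 := by rw [hΛdef, T.sum_level_eq_sum_erase, hempty, sum_empty]
    have hnone : ∀ c, c ≠ T.root → False := fun c hc => by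
      have := mem_erase.2 ⟨hc, mem_univ c⟩
      rw [hempty] at this
      simp at this
    refine ⟨?_, fun _ => T.isStraight_of_down_eq (fun w hw => (hnone w hw).elim)
      ⟨0, fun c hc => (hnone c hc).elim⟩⟩
    rw [hH1, hΛ0] at hM
    rw [hH1]
    norm_num at hM
    norm_num [linearMostar]
    linarith
  · obtain ⟨c, hc, hmax⟩ := exists_max_image T.children (fun c => #(T.sub c))
      (nonempty_iff_ne_empty.2 hch)
    obtain ⟨hc0, hcp⟩ := T.mem_children.1 hc
    set b := #(T.sub c) with hb
    have hbH := hbal c hc0 hcp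
    rw [← hb] at hbH
    have hRb := T.le_sum_closerDiff_root hc0 hcp
    rw [← hb, ← hR, ← hH] at hRb
    have hb1 : 1 ≤ b := card_pos.2 ⟨c, T.mem_sub.2 (T.below_refl c)⟩
    by_cases hbig : H ≤ 2 * b + 1
    · -- The largest branch is as large as possible, and the level sum is estimated in this branch
      -- and in the union of the others.
      obtain ⟨r, hr⟩ : ∃ r, b + r + 1 = H := ⟨H - 1 - b, by omega⟩
      obtain ⟨hΛle, hΛlt⟩ := T.two_mul_sum_level_le_of_child hc hb.symm hr
      rw [← hΛdef] at hΛle hΛlt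
      have key := linearMostar_eq hr hbH hbig
      zify at hΛle
      refine ⟨by linarith, fun heq => ?_⟩
      have hΛeq : ¬∃ c₁ ∈ T.children, ∃ c₂ ∈ T.children, c₁ ≠ c₂ ∧ c₁ ≠ c ∧ c₂ ≠ c := by
        intro h
        have := hΛlt h
        zify at this
        linarith
      refine T.isStraight_of_down_eq (hstep _ (by linarith) heq) ⟨T.down c, ?_⟩
      intro c' hc0' hcp'
      by_cases hcc : c = c'
      · exact Or.inl (by rw [hcc])
      · right
        by_contra hd
        have := T.lt_sum_closerDiff_root hc0 hcp hc0' hcp' hcc hd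
        rw [← hb, ← hR, ← hH] at this
        linarith
    · -- All branches are small, and the bound is strict.
      have hΛle := T.two_mul_sum_level_le_of_forall hmax
      rw [← hΛdef] at hΛle
      have hlt : linearMostar H < mostarIndex G := by
        have h1 : (2 * Λ : ℤ) ≤ ((H : ℤ) - 1) * (b + 1) := by
          have : ((#(univ.erase T.root) : ℕ) : ℤ) = (H : ℤ) - 1 := by
            rw [← hcard]
            push_cast
            ring
          rw [← this]
          exact_mod_cast hΛle
        have h2 : (2 * b + 2 : ℤ) ≤ H := by
          have : 2 * b + 2 ≤ H := by omega
          exact_mod_cast this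
        have h4 : (4 : ℤ) ≤ H := by
          have : 4 ≤ H := by omega
          exact_mod_cast this
        have h3 : ((H : ℤ) - 1) * (18 * H + 24) ≤ mostarIndex G := by nlinarith
        refine lt_of_lt_of_le ?_ h3
        obtain ⟨a, ha⟩ : ∃ a, H = 2 * a ∨ H = 2 * a + 1 := ⟨H / 2, by omega⟩
        rcases ha with ha | ha
        · rw [ha, linearMostar_two_mul]
          rw [ha] at h4
          push_cast at h4 ⊢
          nlinarith
        · rw [ha, linearMostar_two_mul_add_one]
          rw [ha] at h4
          push_cast at h4 ⊢
          nlinarith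
      exact ⟨hlt.le, fun heq => absurd heq hlt.ne'⟩

end HexTree

/-! ### The linear chain -/

theorem linearPhenylene_adj_same {h : ℕ} (v : Fin h) (i j : Fin 6) :
    (linearPhenylene h).Adj (v, i) (v, j) ↔ j = i + 1 ∨ i = j + 1 := by
  have hne : i = j → ¬(j = i + 1 ∨ i = j + 1) := by revert i j; decide
  simp only [linearPhenylene, SimpleGraph.fromRel_adj, ne_eq, Prod.mk.injEq, true_and,
    Nat.succ_ne_self, false_and, or_false]
  tauto

theorem linearPhenylene_adj_of_ne {h : ℕ} {v w : Fin h} (hvw : v ≠ w) (i j : Fin 6) :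
    (linearPhenylene h).Adj (v, i) (w, j) ↔
      (v.val + 1 = w.val ∧ ((i = 0 ∧ j = 4) ∨ (i = 1 ∧ j = 3))) ∨
      (w.val + 1 = v.val ∧ ((j = 0 ∧ i = 4) ∨ (j = 1 ∧ i = 3))) := by
  simp only [linearPhenylene, SimpleGraph.fromRel_adj, ne_eq, Prod.mk.injEq, hvw, Ne.symm hvw,
    false_and, not_false_eq_true, true_and, false_or]

/-- The linear chain as a tree of hexagons that is rooted at its first hexagon. -/
def linearHexTree (n : ℕ) : HexTree (linearPhenylene (n + 1)) where
  root := 0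
  parent v := ⟨v.val - 1, by omega⟩
  level v := v.val
  up _ := 3
  down _ := 0
  fst _ := 1
  snd _ := 0
  parent_root := rfl
  level_root := rfl
  level_parent v hv := by
    have := Fin.pos_iff_ne_zero.2 hv
    rw [Fin.lt_def] at this
    simp only [Fin.val_zero] at this
    simp only
    omega
  ports _ _ := Or.inr ⟨rfl, rfl⟩
  adj_same := linearPhenylene_adj_same
  adj_parent v hv i j := by
    have hpos := Fin.pos_iff_ne_zero.2 hv
    rw [Fin.lt_def] at hpos
    simp only [Fin.val_zero] at hpos
    rw [linearPhenylene_adj_of_ne]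
    · have h1 : ¬v.val + 1 = v.val - 1 := by omega
      have h2 : v.val - 1 + 1 = v.val := by omega
      have h3 : (3 : Fin 6) + 1 = 4 := rfl
      simp only [h1, h2, h3, false_and, false_or, true_and]
      tauto
    · intro h
      have := congrArg Fin.val h
      simp only at this
      omega
  eq_parent v w i j hvw h := by
    rw [linearPhenylene_adj_of_ne hvw] at h
    rcases h with ⟨h, -⟩ | ⟨h, -⟩
    · right
      refine ⟨fun h0 => ?_, Fin.ext ?_⟩
      · rw [h0] at h
        simp at h
      · simp only
        omega
    · left
      refine ⟨fun h0 => ?_, Fin.ext ?_⟩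
      · rw [h0] at h
        simp at h
      · simp only
        omega
  siblings v w hv hw hvw h := by
    have h1 := Fin.pos_iff_ne_zero.2 hv
    have h2 := Fin.pos_iff_ne_zero.2 hw
    rw [Fin.lt_def] at h1 h2
    simp only [Fin.val_zero] at h1 h2
    simp only [Fin.mk.injEq] at h
    exact absurd (Fin.ext (by omega)) hvw
  parent_child _ _ _ _ _ := by decide

theorem card_sub_linearHexTree {n : ℕ} (v : Fin (n + 1)) :
    #((linearHexTree n).sub v) = n + 1 - v.val := by
  have h : (linearHexTree n).sub v = Ici v := by
    ext u
    rw [HexTree.mem_sub, mem_Ici]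
    constructor
    · intro h
      exact Fin.le_def.2 ((linearHexTree n).level_le_of_below h)
    · intro h
      induction u using (linearHexTree n).induction with
      | root =>
        rw [HexTree.below_root_iff]
        exact Fin.le_zero_iff.1 h
      | step u hu ih =>
        by_cases huv : u = v
        · rw [huv]
          exact (linearHexTree n).below_refl v
        · rw [(linearHexTree n).below_iff huv]
          apply ih
          have h1 := lt_of_le_of_ne h (Ne.symm huv)
          rw [Fin.lt_def] at h1
          rw [Fin.le_def]
          have h2 := (linearHexTree n).level_parent u hu
          change u.val = ((linearHexTree n).parent u).val + 1 at h2
          omega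
  rw [h, Fin.card_Ici]

/-- The reflection of the linear chain that fixes every hexagon. -/
def linearReflection (h : ℕ) : linearPhenylene h ≃g linearPhenylene h where
  toFun p := (p.1, 1 - p.2)
  invFun p := (p.1, 1 - p.2)
  left_inv p := by simp
  right_inv p := by simp
  map_rel_iff' := by
    rintro ⟨v, i⟩ ⟨w, j⟩
    simp only [Equiv.coe_fn_mk]
    by_cases hvw : v = w
    · subst hvw
      rw [linearPhenylene_adj_same, linearPhenylene_adj_same]
      revert i j; decide
    · rw [linearPhenylene_adj_of_ne hvw, linearPhenylene_adj_of_ne hvw]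
      have h1 : ((1 - i = 0 ∧ 1 - j = 4) ∨ (1 - i = 1 ∧ 1 - j = 3)) ↔
          ((i = 0 ∧ j = 4) ∨ (i = 1 ∧ j = 3)) := by revert i j; decide
      have h2 : ((1 - j = 0 ∧ 1 - i = 4) ∨ (1 - j = 1 ∧ 1 - i = 3)) ↔
          ((j = 0 ∧ i = 4) ∨ (j = 1 ∧ i = 3)) := by revert i j; decide
      rw [h1, h2]

theorem isGate_linear_Ioi {h : ℕ} (v : Fin h) : IsGate (linearPhenylene h) (Ioi v) v 0 where
  notMem := by simp
  exit := by
    rintro ⟨a, i⟩ ⟨b, j⟩ hadj ha hb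
    simp only [mem_Ioi, not_lt] at ha hb
    have hab : a ≠ b := fun e => absurd (e ▸ ha) (not_lt.2 hb)
    rw [linearPhenylene_adj_of_ne hab] at hadj
    rw [Fin.lt_def] at ha
    rw [Fin.le_def] at hb
    rcases hadj with ⟨h1, -⟩ | ⟨h1, h2⟩
    · omega
    · obtain rfl : b = v := Fin.ext (by omega)
      rcases h2 with ⟨rfl, -⟩ | ⟨rfl, -⟩
      · exact Or.inl rfl
      · exact Or.inr rfl

theorem isGate_linear_Iio {h : ℕ} (v : Fin h) : IsGate (linearPhenylene h) (Iio v) v 3 where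
  notMem := by simp
  exit := by
    rintro ⟨a, i⟩ ⟨b, j⟩ hadj ha hb
    simp only [mem_Iio, not_lt] at ha hb
    have hab : a ≠ b := fun e => absurd (e ▸ ha) (not_lt.2 hb)
    rw [linearPhenylene_adj_of_ne hab] at hadj
    rw [Fin.lt_def] at ha
    rw [Fin.le_def] at hb
    rcases hadj with ⟨h1, h2⟩ | ⟨h1, -⟩
    · obtain rfl : b = v := Fin.ext (by omega)
      rcases h2 with ⟨-, rfl⟩ | ⟨-, rfl⟩
      · exact Or.inr rfl
      · exact Or.inl rfl
    · omega

theorem closerDiff_linear {n : ℕ} (v : Fin (n + 1)) (i : Fin 6) :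
    closerDiff (linearPhenylene (n + 1)) (v, i) (v, i + 1) =
      if i = 0 ∨ i = 0 + 3 then 0 else 6 * |(n : ℤ) - 2 * v.val| := by
  have hG := (linearHexTree n).isHexMatching
  have hgt := isGate_linear_Ioi v
  have hlt := isGate_linear_Iio v
  have hcgt : #(Ioi v) + v.val = n := by
    rw [Fin.card_Ioi]
    omega
  have hclt : #(Iio v) = v.val := Fin.card_Iio v
  split_ifs with hi
  · apply closerDiff_eq_zero_of_swap (linearReflection (n + 1))
    · change (v, 1 - i) = (v, i + 1)
      congr 1
      clear * - hi
      revert i; decide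
    · change (v, 1 - (i + 1)) = (v, i)
      congr 1
      clear * - hi
      revert i; decide
  · have hcases : (i = 1 ∨ i = 2) ∨ (i = 4 ∨ i = 5) := by
      clear * - hi
      revert i; decide
    have hv : (#(Ioi v) : ℤ) + v.val = n := by exact_mod_cast hcgt
    rcases hcases with h | h
    · rw [closerDiff_eq (region (Ioi v) v (lowerHalf i)) (region (Iio v) v (upperHalf i))
        (fun x hx => dist_lt_of_mem_lower hG hgt h hx)
        (fun x hx => dist_lt_of_mem_upper hG hlt h hx),
        card_region hgt.notMem, card_region hlt.notMem, card_lowerHalf, card_upperHalf, hclt]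
      · rw [← hv]
        push_cast
        rw [show (6 * (#(Ioi v) : ℤ) + 3 - (6 * (v.val : ℤ) + 3)) =
          6 * ((#(Ioi v) : ℤ) + v.val - 2 * v.val) by ring, abs_mul]
        rfl
      · rw [card_region hgt.notMem, card_region hlt.notMem, card_lowerHalf, card_upperHalf, hclt,
          Fintype.card_prod, Fintype.card_fin, Fintype.card_fin]
        omega
    · rw [closerDiff_eq (region (Iio v) v (lowerHalf i)) (region (Ioi v) v (upperHalf i))
        (fun x hx => dist_lt_of_mem_lower hG hlt h hx)
        (fun x hx => dist_lt_of_mem_upper hG hgt h hx),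
        card_region hgt.notMem, card_region hlt.notMem, card_lowerHalf, card_upperHalf, hclt]
      · rw [← hv, ← abs_neg]
        push_cast
        rw [show -(6 * (v.val : ℤ) + 3 - (6 * (#(Ioi v) : ℤ) + 3)) =
          6 * ((#(Ioi v) : ℤ) + v.val - 2 * v.val) by ring, abs_mul]
        rfl
      · rw [card_region hgt.notMem, card_region hlt.notMem, card_lowerHalf, card_upperHalf, hclt,
          Fintype.card_prod, Fintype.card_fin, Fintype.card_fin]
        omega

theorem linearMostar_add_two (h : ℕ) :
    linearMostar (h + 2) = linearMostar h + 72 * h + 48 := by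
  unfold linearMostar
  have h1 : ((h / 2 : ℕ) : ℤ) + ((h + 1) / 2 : ℕ) = h := by
    have : h / 2 + (h + 1) / 2 = h := by omega
    exact_mod_cast this
  rw [show (h + 2) / 2 = h / 2 + 1 by omega, show (h + 2 + 1) / 2 = (h + 1) / 2 + 1 by omega,
    ← h1]
  generalize h / 2 = a
  generalize (h + 1) / 2 = c
  push_cast
  ring

/-- The closed form of the sum over the hexagons and links of a chain. The term `v = 0` of the
second sum does not belong to a link, and is taken away again. -/
theorem sum_abs_eq_linearMostar (h : ℕ) :
    24 * ∑ v ∈ range h, |(h : ℤ) - 1 - 2 * v| + 12 * (∑ v ∈ range h, |2 * (v : ℤ) - h| - h) =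
      linearMostar h := by
  induction h using Nat.twoStepInduction with
  | zero => simp [linearMostar]
  | one => simp [linearMostar]
  | more h ih _ =>
    rw [linearMostar_add_two, ← ih, sum_range_succ, sum_range_succ', sum_range_succ,
      sum_range_succ']
    have e1 : ∀ v ∈ range h, |((h + 2 : ℕ) : ℤ) - 1 - 2 * ((v + 1 : ℕ) : ℤ)| =
        |(h : ℤ) - 1 - 2 * v| := fun v _ => by
      push_cast
      congr 1
      ring
    have e2 : ∀ v ∈ range h, |2 * ((v + 1 : ℕ) : ℤ) - ((h + 2 : ℕ) : ℤ)| = |2 * (v : ℤ) - h| :=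
      fun v _ => by
        push_cast
        congr 1
        ring
    have e3 : |((h + 2 : ℕ) : ℤ) - 1 - 2 * ((0 : ℕ) : ℤ)| = h + 1 := by
      rw [abs_of_nonneg] <;> push_cast <;> linarith
    have e4 : |((h + 2 : ℕ) : ℤ) - 1 - 2 * ((h + 1 : ℕ) : ℤ)| = h + 1 := by
      rw [abs_of_nonpos] <;> push_cast <;> linarith
    have e5 : |2 * ((0 : ℕ) : ℤ) - ((h + 2 : ℕ) : ℤ)| = h + 2 := by
      rw [abs_of_nonpos] <;> push_cast <;> linarith
    have e6 : |2 * ((h + 1 : ℕ) : ℤ) - ((h + 2 : ℕ) : ℤ)| = h := by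
      rw [abs_of_nonneg] <;> push_cast <;> linarith
    rw [sum_congr rfl e1, sum_congr rfl e2, e3, e4, e5, e6]
    push_cast
    ring

theorem mostarIndex_linearPhenylene (n : ℕ) :
    mostarIndex (linearPhenylene (n + 1)) = linearMostar (n + 1) := by
  rw [(linearHexTree n).mostarIndex_eq, ← sum_abs_eq_linearMostar]
  congr 1
  · rw [Finset.mul_sum, ← Fin.sum_univ_eq_sum_range
      (fun v => 24 * |((n + 1 : ℕ) : ℤ) - 1 - 2 * (v : ℤ)|)]
    refine sum_congr rfl fun v _ => ?_
    simp only [closerDiff_linear]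
    rw [sum_ite_eq_four_mul]
    push_cast
    rw [add_sub_cancel_right]
    ring
  · have h1 : ∀ v : Fin (n + 1), |(Fintype.card (Fin (n + 1)) : ℤ) -
        2 * #((linearHexTree n).sub v)| = |2 * (v.val : ℤ) - (n + 1 : ℕ)| := by
      intro v
      rw [card_sub_linearHexTree, Fintype.card_fin, Nat.cast_sub v.isLt.le]
      congr 1
      ring
    simp only [h1]
    rw [← Finset.mul_sum, ← Fin.sum_univ_eq_sum_range (fun v => |2 * (v : ℤ) - (n + 1 : ℕ)|),
      ← add_sum_erase univ _ (mem_univ (linearHexTree n).root)]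
    have h2 : |2 * (((linearHexTree n).root.val : ℕ) : ℤ) - (n + 1 : ℕ)| = (n + 1 : ℕ) := by
      change |2 * ((0 : ℕ) : ℤ) - (n + 1 : ℕ)| = (n + 1 : ℕ)
      rw [abs_of_nonpos] <;> push_cast <;> linarith
    rw [h2, add_sub_cancel_left]

theorem mem_polygonEdges_four {V : Type*} (c : Fin 4 → V) (e : Sym2 V) :
    e ∈ polygonEdges c ↔ e = s(c 0, c 1) ∨ e = s(c 1, c 2) ∨ e = s(c 2, c 3) ∨ e = s(c 3, c 0) := by
  unfold polygonEdges
  rw [Set.mem_range]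
  constructor
  · rintro ⟨k, rfl⟩
    fin_cases k <;> simp
  · rintro (rfl | rfl | rfl | rfl)
    · exact ⟨0, rfl⟩
    · exact ⟨1, rfl⟩
    · exact ⟨2, rfl⟩
    · exact ⟨3, rfl⟩

theorem mk_mem_polygonEdges_hexagon {ι : Type*} {u v w : ι} {i j : Fin 6} :
    s((v, i), (w, j)) ∈ polygonEdges (fun k : Fin 6 => (u, k)) ↔
      v = u ∧ w = u ∧ (j = i + 1 ∨ i = j + 1) := by
  unfold polygonEdges
  rw [Set.mem_range]
  simp only [Sym2.eq_iff, Prod.mk.injEq]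
  constructor
  · rintro ⟨k, ⟨⟨rfl, rfl⟩, rfl, rfl⟩ | ⟨⟨rfl, rfl⟩, rfl, rfl⟩⟩ <;> simp
  · rintro ⟨rfl, rfl, rfl | rfl⟩
    · exact ⟨i, by simp⟩
    · exact ⟨j, by simp⟩

/-- The vertices of the quadrilateral between the hexagons `j` and `j + 1` of the linear chain. -/
def linearQuad (n : ℕ) (j : Fin n) : Fin 4 → Fin (n + 1) × Fin 6 :=
  ![(j.castSucc, 0), (j.castSucc, 1), (j.succ, 3), (j.succ, 4)]

theorem isTreeLikePhenylene_linearPhenylene (n : ℕ) :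
    IsTreeLikePhenylene (linearPhenylene (n + 1)) (n + 1) := by
  refine ⟨fun i k => (i, k), linearQuad n, ?_, ?_, ?_, ?_, (linearHexTree n).connected⟩
  · exact Function.bijective_id
  · rintro ⟨j, a⟩ ⟨j', a'⟩ h
    have hne : j.castSucc = j'.castSucc ↔ j = j' := Fin.castSucc_inj
    have hne' : j.succ = j'.succ ↔ j = j' := Fin.succ_inj
    fin_cases a <;> fin_cases a' <;> simp_all [linearQuad]
  · rintro ⟨v, i⟩ ⟨w, j⟩
    simp only [mk_mem_polygonEdges_hexagon, mem_polygonEdges_four]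
    simp only [linearQuad, Matrix.cons_val]
    by_cases hvw : v = w
    · subst hvw
      rw [linearPhenylene_adj_same]
      constructor
      · intro h
        exact Or.inl ⟨v, rfl, rfl, h⟩
      · rintro (⟨_, -, -, h⟩ | ⟨k, h⟩)
        · exact h
        · have hk : k.castSucc ≠ k.succ := (Fin.castSucc_lt_succ).ne
          simp only [Sym2.eq_iff, Prod.mk.injEq] at h
          revert i j
          grind
    · rw [linearPhenylene_adj_of_ne hvw]
      constructor
      · rintro (⟨h1, h2⟩ | ⟨h1, h2⟩)
        · right
          obtain ⟨k, rfl, rfl⟩ : ∃ k : Fin n, v = k.castSucc ∧ w = k.succ :=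
            ⟨⟨v.val, by omega⟩, rfl, Fin.ext h1.symm⟩
          refine ⟨k, ?_⟩
          rcases h2 with ⟨rfl, rfl⟩ | ⟨rfl, rfl⟩
          · exact Or.inr (Or.inr (Or.inr Sym2.eq_swap))
          · exact Or.inr (Or.inl rfl)
        · right
          obtain ⟨k, rfl, rfl⟩ : ∃ k : Fin n, w = k.castSucc ∧ v = k.succ :=
            ⟨⟨w.val, by omega⟩, rfl, Fin.ext h1.symm⟩
          refine ⟨k, ?_⟩
          rcases h2 with ⟨rfl, rfl⟩ | ⟨rfl, rfl⟩
          · exact Or.inr (Or.inr (Or.inr rfl))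
          · exact Or.inr (Or.inl Sym2.eq_swap)
      · rintro (⟨_, rfl, rfl, h⟩ | ⟨k, h⟩)
        · exact absurd rfl hvw
        · simp only [Sym2.eq_iff, Prod.mk.injEq] at h
          have h1 : k.castSucc.val = k.val := rfl
          have h2 : k.succ.val = k.val + 1 := rfl
          rcases h with (h | h) | (h | h) | (h | h) | (h | h) <;>
            obtain ⟨⟨rfl, rfl⟩, rfl, rfl⟩ := h <;> simp at hvw ⊢
  · intro j
    have hj : j.castSucc ≠ j.succ := (Fin.castSucc_lt_succ).ne
    rw [← Set.ncard_pair hj]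
    congr 1
    ext i
    simp only [Set.mem_ofPred_eq, Set.mem_insert_iff, Set.mem_singleton_iff]
    constructor
    · rintro ⟨e, he, he'⟩
      rw [mem_polygonEdges_four] at he'
      simp only [linearQuad, Matrix.cons_val] at he'
      rcases he' with rfl | rfl | rfl | rfl <;> rw [mk_mem_polygonEdges_hexagon] at he
      · exact Or.inl he.1.symm
      · exact Or.inl he.1.symm
      · exact Or.inr he.1.symm
      · exact Or.inr he.1.symm
    · rintro (rfl | rfl)
      · exact ⟨s((j.castSucc, 0), (j.castSucc, 1)), mk_mem_polygonEdges_hexagon.2 (by simp),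
          (mem_polygonEdges_four _ _).2 (Or.inl rfl)⟩
      · exact ⟨s((j.succ, 3), (j.succ, 4)), mk_mem_polygonEdges_hexagon.2 ⟨rfl, rfl, Or.inl rfl⟩,
          (mem_polygonEdges_four _ _).2 (Or.inr (Or.inr (Or.inl rfl)))⟩

/-! ### The tree of hexagons of a phenylene -/

theorem polygonEdges_comp {V W : Type*} {n : ℕ} [NeZero n] (f : V → W) (c : Fin n → V) :
    polygonEdges (fun k => f (c k)) = Sym2.map f '' polygonEdges c := by
  unfold polygonEdges
  rw [← Set.range_comp]
  rfl

theorem mem_range_of_mk_mem_polygonEdges {V : Type*} {n : ℕ} [NeZero n] {c : Fin n → V} {x y : V}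
    (h : s(x, y) ∈ polygonEdges c) : x ∈ Set.range c ∧ y ∈ Set.range c := by
  obtain ⟨k, hk⟩ := h
  simp only [Sym2.eq_iff] at hk
  rcases hk with ⟨rfl, rfl⟩ | ⟨rfl, rfl⟩ <;> simp

/-- The hexagons of a phenylene give its vertices the coordinates `(hexagon, position)`. -/
theorem exists_iso_coordinates {V : Type*} {G : SimpleGraph V} {h : ℕ}
    (hG : IsTreeLikePhenylene G h) :
    ∃ (G' : SimpleGraph (Fin h × Fin 6)) (quad : Fin (h - 1) → Fin 4 → Fin h × Fin 6),
      IsTreeLikePhenyleneWith G' h (fun i k => (i, k)) quad ∧ Nonempty (G' ≃g G) := by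
  obtain ⟨hex, quad, hP⟩ := hG
  let E : Fin h × Fin 6 ≃ V := Equiv.ofBijective _ hP.hex_bijective
  have hE : ∀ i k, E (i, k) = hex i k := fun i k => rfl
  have hinj : Function.Injective (Sym2.map E) := Sym2.map.injective E.injective
  have hhex : ∀ i, polygonEdges (hex i) =
      Sym2.map E '' polygonEdges (fun k : Fin 6 => (i, k)) := fun i => by
    rw [← polygonEdges_comp]
    rfl
  have hquad : ∀ j, polygonEdges (quad j) =
      Sym2.map E '' polygonEdges (fun t => E.symm (quad j t)) := fun j => by
    rw [← polygonEdges_comp]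
    simp
  refine ⟨G.comap E, fun j t => E.symm (quad j t), ?_, ⟨SimpleGraph.Iso.comap E G⟩⟩
  refine ⟨Function.bijective_id, E.symm.injective.comp hP.quad_injective, ?_, ?_, ?_⟩
  · intro x y
    rw [SimpleGraph.comap_adj, hP.adj_iff]
    simp only [hhex, hquad, ← Sym2.map_mk, hinj.mem_set_image]
  · intro j
    rw [← hP.joined j]
    congr 1
    ext i
    simp only [Set.mem_ofPred_eq, hhex i, hquad j, ← Set.image_inter hinj, Set.image_nonempty]
  · exact (SimpleGraph.Iso.comap E G).connected_iff.2 hP.connected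

section Link

variable {ι : Type*}

/-- The quadrilateral `c` links the hexagons `v` and `w`: it consists of the edge `{k, k + 1}` of
`v`, the edge `{n, n + 1} = {m, m'}` of `w`, and two rungs that join `k` to `m` and `k + 1` to
`m'`. -/
def IsLink (c : Fin 4 → ι × Fin 6) (v w : ι) (k n m m' : Fin 6) : Prop :=
  v ≠ w ∧ ((m = n ∧ m' = n + 1) ∨ (m = n + 1 ∧ m' = n)) ∧
    ∀ e, e ∈ polygonEdges c ↔ e = s((v, k), (v, k + 1)) ∨ e = s((w, n), (w, n + 1)) ∨
      e = s((v, k), (w, m)) ∨ e = s((v, k + 1), (w, m'))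

namespace IsLink

variable {c : Fin 4 → ι × Fin 6} {v w v' w' : ι} {k n m m' k' n' m₂ m₂' : Fin 6}

theorem symm (h : IsLink c v w k n m m') : ∃ m₂ m₂', IsLink c w v n k m₂ m₂' := by
  obtain ⟨hne, ⟨rfl, rfl⟩ | ⟨rfl, rfl⟩, he⟩ := h
  · refine ⟨k, k + 1, hne.symm, Or.inl ⟨rfl, rfl⟩, fun e => ?_⟩
    rw [he, @Sym2.eq_swap _ (v, k) (w, m), @Sym2.eq_swap _ (v, k + 1) (w, m + 1)]
    tauto
  · refine ⟨k + 1, k, hne.symm, Or.inr ⟨rfl, rfl⟩, fun e => ?_⟩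
    rw [he, @Sym2.eq_swap _ (v, k) (w, m' + 1), @Sym2.eq_swap _ (v, k + 1) (w, m')]
    tauto

theorem mem_range_left (h : IsLink c v w k n m m') :
    (v, k) ∈ Set.range c ∧ (v, k + 1) ∈ Set.range c :=
  mem_range_of_mk_mem_polygonEdges ((h.2.2 _).2 (Or.inl rfl))

theorem mem_range_right (h : IsLink c v w k n m m') :
    (w, n) ∈ Set.range c ∧ (w, n + 1) ∈ Set.range c :=
  mem_range_of_mk_mem_polygonEdges ((h.2.2 _).2 (Or.inr (Or.inl rfl)))

theorem rung_cases (h : IsLink c v w k n m m') {a b : ι} {i j : Fin 6} (hab : a ≠ b)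
    (he : s((a, i), (b, j)) ∈ polygonEdges c) :
    (a = v ∧ b = w ∧ ((i = k ∧ j = m) ∨ (i = k + 1 ∧ j = m'))) ∨
      (a = w ∧ b = v ∧ ((j = k ∧ i = m) ∨ (j = k + 1 ∧ i = m'))) := by
  rw [h.2.2] at he
  simp only [Sym2.eq_iff, Prod.mk.injEq] at he
  rcases he with (he | he) | (he | he) | (he | he) | (he | he) <;>
    obtain ⟨⟨h1, h2⟩, h3, h4⟩ := he
  · exact absurd (h1.trans h3.symm) hab
  · exact absurd (h1.trans h3.symm) hab
  · exact absurd (h1.trans h3.symm) hab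
  · exact absurd (h1.trans h3.symm) hab
  · exact Or.inl ⟨h1, h3, Or.inl ⟨h2, h4⟩⟩
  · exact Or.inr ⟨h1, h3, Or.inl ⟨h4, h2⟩⟩
  · exact Or.inl ⟨h1, h3, Or.inr ⟨h2, h4⟩⟩
  · exact Or.inr ⟨h1, h3, Or.inr ⟨h4, h2⟩⟩

theorem same_cases (h : IsLink c v w k n m m') {a : ι} {i j : Fin 6}
    (he : s((a, i), (a, j)) ∈ polygonEdges c) : j = i + 1 ∨ i = j + 1 := by
  have hne := h.1
  rw [h.2.2] at he
  simp only [Sym2.eq_iff, Prod.mk.injEq] at he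
  rcases he with (he | he) | (he | he) | (he | he) | (he | he) <;> grind

theorem left_cases (h : IsLink c v w k n m m') (h' : IsLink c v' w' k' n' m₂ m₂') :
    v = v' ∨ v = w' := by
  have he := (h'.2.2 _).1 ((h.2.2 _).2 (Or.inl rfl))
  have hne := h'.1
  simp only [Sym2.eq_iff, Prod.mk.injEq] at he
  rcases he with (he | he) | (he | he) | (he | he) | (he | he) <;> grind

end IsLink

theorem mem_polygonEdges_rotate {V : Type*} (c : Fin 4 → V) (t : Fin 4) (e : Sym2 V) :
    e ∈ polygonEdges c ↔ e = s(c t, c (t + 1)) ∨ e = s(c (t + 1), c (t + 2)) ∨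
      e = s(c (t + 2), c (t + 3)) ∨ e = s(c (t + 3), c t) := by
  rw [mem_polygonEdges_four]
  fin_cases t <;> simp <;> tauto

/-- A quadrilateral that shares edges with exactly two of the disjoint hexagons links them. -/
theorem exists_isLink {c : Fin 4 → ι × Fin 6}
    (h2 : {i | (polygonEdges (fun k : Fin 6 => (i, k)) ∩ polygonEdges c).Nonempty}.ncard = 2) :
    ∃ v w k n m m', IsLink c v w k n m m' := by
  obtain ⟨v, w, hvw, hset⟩ := Set.ncard_eq_two.1 h2
  have key : ∀ i ∈ ({v, w} : Set ι), ∃ (t : Fin 4) (k : Fin 6),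
      (c t = (i, k) ∧ c (t + 1) = (i, k + 1)) ∨ (c t = (i, k + 1) ∧ c (t + 1) = (i, k)) := by
    intro i hi
    rw [← hset] at hi
    obtain ⟨e, ⟨k, hk⟩, ⟨t, ht⟩⟩ := hi
    refine ⟨t, k, ?_⟩
    have := ht.trans hk.symm
    rwa [Sym2.eq_iff] at this
  obtain ⟨t, k, hk⟩ := key v (Or.inl rfl)
  obtain ⟨t', n, hn⟩ := key w (Or.inr rfl)
  have hv : (c t).1 = v ∧ (c (t + 1)).1 = v := by rcases hk with hk | hk <;> simp [hk]
  have hw : (c t').1 = w ∧ (c (t' + 1)).1 = w := by rcases hn with hn | hn <;> simp [hn]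
  have ht : t' = t + 2 := by
    have h1 : t' ≠ t := fun e => hvw (by rw [← hv.1, ← hw.1, e])
    have h3 : t' ≠ t + 1 := fun e => hvw (by rw [← hv.2, ← hw.1, e])
    have h4 : t' + 1 ≠ t := fun e => hvw (by rw [← hv.1, ← hw.2, e])
    clear * - h1 h3 h4
    revert t t'; decide
  subst ht
  rw [add_assoc, show (2 : Fin 4) + 1 = 3 from rfl] at hn
  have hrot := mem_polygonEdges_rotate c t
  rcases hk with ⟨a1, a2⟩ | ⟨a1, a2⟩ <;> rcases hn with ⟨b1, b2⟩ | ⟨b1, b2⟩ <;>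
    rw [a1, a2, b1, b2] at hrot
  · refine ⟨v, w, k, n, n + 1, n, hvw, Or.inr ⟨rfl, rfl⟩, fun e => ?_⟩
    rw [hrot, @Sym2.eq_swap _ (w, n + 1) (v, k)]
    tauto
  · refine ⟨v, w, k, n, n, n + 1, hvw, Or.inl ⟨rfl, rfl⟩, fun e => ?_⟩
    rw [hrot, @Sym2.eq_swap _ (w, n + 1) (w, n), @Sym2.eq_swap _ (w, n) (v, k)]
    tauto
  · refine ⟨v, w, k, n, n, n + 1, hvw, Or.inl ⟨rfl, rfl⟩, fun e => ?_⟩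
    rw [hrot, @Sym2.eq_swap _ (v, k + 1) (v, k), @Sym2.eq_swap _ (w, n + 1) (v, k + 1)]
    tauto
  · refine ⟨v, w, k, n, n + 1, n, hvw, Or.inr ⟨rfl, rfl⟩, fun e => ?_⟩
    rw [hrot, @Sym2.eq_swap _ (v, k + 1) (v, k), @Sym2.eq_swap _ (w, n + 1) (w, n),
      @Sym2.eq_swap _ (w, n) (v, k + 1)]
    tauto

/-- The graph of the hexagons, in which linked hexagons are adjacent. -/
def hexGraph (G : SimpleGraph (ι × Fin 6)) : SimpleGraph ι where
  Adj v w := v ≠ w ∧ ∃ i j, G.Adj (v, i) (w, j)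
  symm := ⟨fun _ _ ⟨h, i, j, hij⟩ => ⟨h.symm, j, i, hij.symm⟩⟩
  loopless := ⟨fun _ h => h.1 rfl⟩

theorem hexGraph_connected {G : SimpleGraph (ι × Fin 6)} (hG : G.Connected) :
    (hexGraph G).Connected := by
  have : Nonempty ι := hG.nonempty.map Prod.fst
  refine SimpleGraph.Connected.mk fun v w => ?_
  have key : ∀ x y : ι × Fin 6, G.Walk x y → (hexGraph G).Reachable x.1 y.1 := by
    intro x y p
    induction p with
    | nil => exact SimpleGraph.Reachable.refl _
    | @cons a b c hab _ ih =>
      by_cases h : a.1 = b.1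
      · rwa [h]
      · have hadj : (hexGraph G).Adj a.1 b.1 := ⟨h, a.2, b.2, hab⟩
        exact hadj.reachable.trans ih
  obtain ⟨p⟩ := hG.preconnected (v, 0) (w, 0)
  exact key _ _ p

end Link

/-- A tree-like phenylene can be rooted at any hexagon `r`. A link to a hexagon closer to `r` is
chosen for each of the `h - 1` other hexagons; these links are different, so that they are all of
the `h - 1` quadrilaterals. -/
theorem exists_hexTree {h : ℕ} {G : SimpleGraph (Fin h × Fin 6)}
    {quad : Fin (h - 1) → Fin 4 → Fin h × Fin 6}
    (hG : IsTreeLikePhenyleneWith G h (fun i k => (i, k)) quad) (r : Fin h) :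
    ∃ T : HexTree G, T.root = r ∧ ∀ v, T.level v = (hexGraph G).dist v r := by
  have hD := hexGraph_connected hG.connected
  have hlinks : ∀ j, ∃ v w k n m m', IsLink (quad j) v w k n m m' :=
    fun j => exists_isLink (hG.joined j)
  have hadj : ∀ v w i j, v ≠ w → G.Adj (v, i) (w, j) →
      ∃ t, s((v, i), (w, j)) ∈ polygonEdges (quad t) := by
    intro v w i j hvw h
    rcases (hG.adj_iff _ _).1 h with ⟨u, hu⟩ | h
    · rw [mk_mem_polygonEdges_hexagon] at hu
      exact absurd (hu.1.trans hu.2.1.symm) hvw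
    · exact h
  have hex : ∀ v, ∃ p k n m m', (v = r → p = r) ∧ (v ≠ r →
      (hexGraph G).dist v r = (hexGraph G).dist p r + 1 ∧
        ∃ t, IsLink (quad t) v p k n m m') := by
    intro v
    by_cases hv : v = r
    · exact ⟨r, 0, 0, 0, 0, fun _ => rfl, fun h => absurd hv h⟩
    · obtain ⟨p, ⟨hvp, i, j, hij⟩, hd⟩ := exists_adj_dist_add_one hD hv
      obtain ⟨t, ht⟩ := hadj v p i j hvp hij
      obtain ⟨a, b, k, n, m, m', hl⟩ := hlinks t
      rcases hl.rung_cases hvp ht with ⟨rfl, rfl, -⟩ | ⟨rfl, rfl, -⟩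
      · exact ⟨p, k, n, m, m', fun h => absurd h hv, fun _ => ⟨hd.symm, t, hl⟩⟩
      · obtain ⟨m₂, m₂', hl'⟩ := hl.symm
        exact ⟨p, n, k, m₂, m₂', fun h => absurd h hv, fun _ => ⟨hd.symm, t, hl'⟩⟩
  choose p k n m m' hp0 hp using hex
  have hj : ∀ v : {v // v ≠ r}, ∃ t, IsLink (quad t) v (p v) (k v) (n v) (m v) (m' v) :=
    fun v => (hp v v.2).2
  choose q hq using hj
  have hlev : ∀ v, v ≠ r → (hexGraph G).dist v r = (hexGraph G).dist (p v) r + 1 :=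
    fun v hv => (hp v hv).1
  have hnot : ∀ v w, v ≠ r → w ≠ r → v = p w → w = p v → False := by
    intro v w hv hw h1 h2
    have e1 := hlev v hv
    have e2 := hlev w hw
    rw [← h2] at e1
    rw [← h1] at e2
    omega
  have hqinj : Function.Injective q := by
    intro v w hvw
    have h1 := hq v
    have h2 := hq w
    rw [hvw] at h1
    rcases h1.left_cases h2 with h | h
    · exact Subtype.ext h
    · rcases h2.left_cases h1 with h' | h'
      · exact (Subtype.ext h').symm
      · exact (hnot v w v.2 w.2 h h').elim
  have hqsurj : Function.Surjective q := by
    refine ((Fintype.bijective_iff_injective_and_card q).2 ⟨hqinj, ?_⟩).2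
    rw [Fintype.card_subtype_compl, Fintype.card_subtype_eq, Fintype.card_fin, Fintype.card_fin]
  have hrung : ∀ a b i j, a ≠ b → G.Adj (a, i) (b, j) → ∃ v, v ≠ r ∧
      ((a = v ∧ b = p v ∧ ((i = k v ∧ j = m v) ∨ (i = k v + 1 ∧ j = m' v))) ∨
      (a = p v ∧ b = v ∧ ((j = k v ∧ i = m v) ∨ (j = k v + 1 ∧ i = m' v)))) := by
    intro a b i j hab h
    obtain ⟨t, ht⟩ := hadj a b i j hab h
    obtain ⟨v, rfl⟩ := hqsurj t
    exact ⟨v, v.2, (hq v).rung_cases hab ht⟩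
  have hdisj : ∀ v w (hv : v ≠ r) (hw : w ≠ r), v ≠ w → ∀ x ∈ Set.range (quad (q ⟨v, hv⟩)),
      ∀ y ∈ Set.range (quad (q ⟨w, hw⟩)), x ≠ y := by
    rintro v w hv hw hvw _ ⟨s, rfl⟩ _ ⟨t, rfl⟩ heq
    have : (q ⟨v, hv⟩, s) = (q ⟨w, hw⟩, t) := hG.quad_injective heq
    have := hqinj (Prod.mk.inj this).1
    exact hvw (congrArg Subtype.val this)
  refine ⟨{
    root := r
    parent := p
    level := fun v => (hexGraph G).dist v r
    up := k
    down := n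
    fst := m
    snd := m'
    parent_root := hp0 r rfl
    level_root := SimpleGraph.dist_self
    level_parent := hlev
    ports := fun v hv => (hq ⟨v, hv⟩).2.1
    adj_same := ?_
    adj_parent := ?_
    eq_parent := ?_
    siblings := ?_
    parent_child := ?_ }, rfl, fun _ => rfl⟩
  · intro v i j
    rw [hG.adj_iff]
    constructor
    · rintro (⟨u, hu⟩ | ⟨t, ht⟩)
      · exact (mk_mem_polygonEdges_hexagon.1 hu).2.2
      · obtain ⟨a, b, k, n, m, m', hl⟩ := hlinks t
        exact hl.same_cases ht
    · intro h
      exact Or.inl ⟨v, mk_mem_polygonEdges_hexagon.2 ⟨rfl, rfl, h⟩⟩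
  · intro v hv i j
    constructor
    · intro h
      obtain ⟨w, hw, ⟨rfl, -, h'⟩ | ⟨h1, h2, -⟩⟩ := hrung v (p v) i j (hq ⟨v, hv⟩).1 h
      · exact h'
      · exact (hnot v w hv hw h1 h2.symm).elim
    · intro h
      rw [hG.adj_iff]
      refine Or.inr ⟨q ⟨v, hv⟩, ((hq ⟨v, hv⟩).2.2 _).2 (Or.inr (Or.inr ?_))⟩
      rcases h with ⟨rfl, rfl⟩ | ⟨rfl, rfl⟩
      · exact Or.inl rfl
      · exact Or.inr rfl
  · intro v w i j hvw h
    obtain ⟨u, hu, ⟨rfl, h', -⟩ | ⟨h', rfl, -⟩⟩ := hrung v w i j hvw h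
    · exact Or.inl ⟨hu, h'⟩
    · exact Or.inr ⟨hu, h'⟩
  · intro v w hv hw hvw hpp
    have h1 := (hq ⟨v, hv⟩).mem_range_right
    have h2 := (hq ⟨w, hw⟩).mem_range_right
    simp only [hpp] at h1
    refine ⟨fun e => ?_, fun e => ?_, fun e => ?_⟩
    · exact hdisj v w hv hw hvw _ h1.1 _ h2.1 (by rw [e])
    · exact hdisj v w hv hw hvw _ h1.2 _ h2.1 (by rw [e])
    · exact hdisj v w hv hw hvw _ h1.1 _ h2.2 (by rw [e])
  · intro v w hv hw hpv
    have h1 := (hq ⟨v, hv⟩).mem_range_left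
    have h2 := (hq ⟨w, hw⟩).mem_range_right
    have hvw : v ≠ w := fun e => (hq ⟨w, hw⟩).1 (by rw [hpv, e])
    simp only [hpv] at h2
    refine ⟨fun e => ?_, fun e => ?_, fun e => ?_⟩
    · exact hdisj v w hv hw hvw _ h1.1 _ h2.1 (by rw [e])
    · exact hdisj v w hv hw hvw _ h1.2 _ h2.1 (by rw [e])
    · exact hdisj v w hv hw hvw _ h1.1 _ h2.2 (by rw [e])

/-! ### A balanced root -/

namespace HexTree

variable {ι : Type*} {G : SimpleGraph (ι × Fin 6)} (T : HexTree G)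

theorem hexGraph_adj_parent {v : ι} (hv : v ≠ T.root) : (hexGraph G).Adj v (T.parent v) :=
  ⟨(T.parent_ne hv).symm, _, _, T.adj_fst hv⟩

theorem dist_add_level_le (hD : (hexGraph G).Connected) {c u : ι} (h : T.Below c u) :
    (hexGraph G).dist u c + T.level c ≤ T.level u := by
  induction u using T.induction with
  | root =>
    rw [T.below_root_iff.1 h, SimpleGraph.dist_self, zero_add]
  | step u hu ih =>
    by_cases huc : u = c
    · rw [huc, SimpleGraph.dist_self, zero_add]
    · have h1 := ih ((T.below_iff huc).1 h)
      have h2 : (hexGraph G).dist u c ≤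
        (hexGraph G).dist u (T.parent u) + (hexGraph G).dist (T.parent u) c := hD.dist_triangle
      rw [SimpleGraph.dist_eq_one_iff_adj.2 (T.hexGraph_adj_parent hu)] at h2
      have h3 := T.level_parent u hu
      omega

variable [Fintype ι]

/-- If the root minimizes the sum of the distances to all hexagons, then no branch has more than
half of the hexagons: a step towards a larger branch would make the sum smaller. -/
theorem two_mul_card_sub_le (hD : (hexGraph G).Connected)
    (hlev : ∀ v, T.level v = (hexGraph G).dist v T.root)
    (hmin : ∀ c, ∑ u, (hexGraph G).dist u T.root ≤ ∑ u, (hexGraph G).dist u c) (c : ι)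
    (hc : c ≠ T.root) (hcp : T.parent c = T.root) : 2 * #(T.sub c) ≤ Fintype.card ι := by
  classical
  have hadj := T.hexGraph_adj_parent hc
  rw [hcp] at hadj
  have hlc : T.level c = 1 := by rw [T.level_parent c hc, hcp, T.level_root]
  have hle : ∀ u ∈ (univ : Finset ι), (hexGraph G).dist u c + (if u ∈ T.sub c then 2 else 0) ≤
      (hexGraph G).dist u T.root + 1 := by
    intro u _
    split_ifs with hu
    · have := T.dist_add_level_le hD (T.mem_sub.1 hu)
      rw [hlc, hlev u] at this
      omega
    · have h2 : (hexGraph G).dist u c ≤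
        (hexGraph G).dist u T.root + (hexGraph G).dist T.root c := hD.dist_triangle
      rw [SimpleGraph.dist_eq_one_iff_adj.2 hadj.symm] at h2
      omega
  have hsum := Finset.sum_le_sum hle
  rw [Finset.sum_add_distrib, Finset.sum_add_distrib, ← Finset.sum_filter, Finset.sum_const,
    Finset.sum_const, Finset.filter_univ_mem, card_univ] at hsum
  have := hmin c
  simp only [smul_eq_mul, mul_one] at hsum
  omega

end HexTree

/-! ### Straight phenylenes are linear chains -/

/-- The hexagon `r` has neighbours in other hexagons at one of its edges at most. -/
def IsLeaf {ι : Type*} (G : SimpleGraph (ι × Fin 6)) (r : ι) : Prop :=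
  ∃ k : Fin 6, ∀ i y, y.1 ≠ r → G.Adj (r, i) y → i = k ∨ i = k + 1

namespace HexTree

variable {ι : Type*} {G : SimpleGraph (ι × Fin 6)} (T : HexTree G)

theorem exists_level_eq {v : ι} {t : ℕ} (ht : t ≤ T.level v) : ∃ w, T.level w = t := by
  induction v using T.induction with
  | root =>
    rw [T.level_root] at ht
    exact ⟨T.root, by rw [T.level_root]; omega⟩
  | step v hv ih =>
    rcases Nat.lt_or_ge t (T.level v) with h | h
    · rw [T.level_parent v hv] at h
      exact ih (by omega)
    · exact ⟨v, by omega⟩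

theorem level_lt_card [Fintype ι] (v : ι) : T.level v < Fintype.card ι := by
  classical
  have h : range (T.level v + 1) ⊆ univ.image T.level := by
    intro t ht
    obtain ⟨w, hw⟩ := T.exists_level_eq (v := v) (t := t) (by
      rw [Finset.mem_range] at ht
      omega)
    exact mem_image.2 ⟨w, mem_univ w, hw⟩
  have h1 := card_le_card h
  have h2 := card_image_le (s := univ) (f := T.level)
  rw [card_range] at h1
  rw [card_univ] at h2
  omega

/-- In a tree of hexagons without branching, the levels are different. -/
theorem level_injective (h : ∀ v w, v ≠ T.root → w ≠ T.root → T.parent v = T.parent w → v = w) :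
    Function.Injective T.level := by
  intro v
  induction v using T.induction with
  | root =>
    intro w hw
    rw [T.level_root] at hw
    exact (T.level_eq_zero_iff.1 hw.symm).symm
  | step v hv ih =>
    intro w hw
    have hv' := T.level_parent v hv
    have hw0 : w ≠ T.root := by
      rintro rfl
      rw [T.level_root] at hw
      omega
    have hw' := T.level_parent w hw0
    exact h v w hv hw0 (ih (by omega))

/-- A hexagon of the highest level is a leaf. -/
theorem exists_isLeaf [Finite ι] (T : HexTree G) : ∃ r, IsLeaf G r := by
  have : Nonempty ι := ⟨T.root⟩
  obtain ⟨r, hr⟩ := Finite.exists_max T.level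
  refine ⟨r, T.up r, fun i y hy h => ?_⟩
  rcases T.outer_cases hy h with ⟨-, h⟩ | ⟨w, hw, rfl, -⟩
  · exact h
  · have h1 := T.level_parent w hw
    have h2 := hr w
    omega

theorem exists_outer_down {w : ι} (hw : w ≠ T.root) {j : Fin 6}
    (hj : j = T.down w ∨ j = T.down w + 1) :
    ∃ y : ι × Fin 6, y.1 ≠ T.parent w ∧ G.Adj (T.parent w, j) y := by
  obtain ⟨i, hi⟩ := T.exists_adj_down hw hj
  exact ⟨_, (T.parent_ne hw).symm, hi⟩

theorem down_eq_of_isLeaf (hleaf : IsLeaf G T.root) :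
    ∃ d, ∀ c, c ≠ T.root → T.parent c = T.root → T.down c = d := by
  obtain ⟨k, hk⟩ := hleaf
  refine ⟨k, fun c hc hcp => ?_⟩
  obtain ⟨y, hy, hadj⟩ := T.exists_outer_down hc (Or.inl rfl)
  obtain ⟨z, hz, hadj'⟩ := T.exists_outer_down hc (Or.inr rfl)
  rw [hcp] at hy hadj hz hadj'
  have h1 := hk _ y hy hadj
  have h2 := hk _ z hz hadj'
  generalize T.down c = a at *
  clear * - h1 h2
  revert k a; decide

theorem down_eq_of_isStraight (hs : IsStraight G) {w : ι} (hw : w ≠ T.root)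
    (hv : T.parent w ≠ T.root) : T.down w = T.up (T.parent w) + 3 := by
  obtain ⟨k, hk⟩ := hs (T.parent w)
  have key : ∀ i y, y.1 ≠ T.parent w → G.Adj (T.parent w, i) y → i ≠ k ∧ i ≠ k + 3 := by
    intro i y hy h
    refine ⟨?_, ?_⟩ <;> rintro rfl
    · exact (hk y hy).1 h
    · exact (hk y hy).2 h
  obtain ⟨y, hy, hadj⟩ := T.exists_outer_down hw (Or.inl rfl)
  obtain ⟨z, hz, hadj'⟩ := T.exists_outer_down hw (Or.inr rfl)
  have h1 := key _ y hy hadj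
  have h2 := key _ z hz hadj'
  have h3 := key _ _ (T.parent_ne hv) (T.adj_fst hv)
  have h4 := key _ _ (T.parent_ne hv) (T.adj_snd hv)
  have h5 := T.parent_child _ w hv hw rfl
  generalize T.down w = a at *
  generalize T.up (T.parent w) = b at *
  clear * - h1 h2 h3 h4 h5
  revert k a b; decide

/-- The coordinates of the linear chain on the hexagon `v`, if `φ` gives those on its parent: the
position `4` faces the position `0` of the parent and `3` faces `1`. -/
def nextFrame (v : ι) (φ : Fin 6 → Fin 6) : Fin 6 → Fin 6 := fun i =>
  if φ 0 = T.fst v then T.up v + 4 - i else T.up v + 3 + i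

/-- The coordinates on a hexagon of level `n`; `d` is the edge of the root at which its child is
attached. -/
def frameAux (d : Fin 6) : ℕ → ι → Fin 6 → Fin 6
  | 0, _ => fun i => d + i
  | n + 1, v => T.nextFrame v (frameAux d n (T.parent v))

/-- The coordinates of the linear chain on the hexagon `v`. -/
def frame (d : Fin 6) (v : ι) : Fin 6 → Fin 6 := T.frameAux d (T.level v) v

theorem frame_root (d : Fin 6) (i : Fin 6) : T.frame d T.root i = d + i := by
  rw [frame, T.level_root]
  rfl

theorem frame_of_ne (d : Fin 6) {v : ι} (hv : v ≠ T.root) (i : Fin 6) :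
    T.frame d v i =
      if T.frame d (T.parent v) 0 = T.fst v then T.up v + 4 - i else T.up v + 3 + i := by
  rw [frame, T.level_parent v hv]
  rfl

theorem frame_cases (d : Fin 6) (v : ι) :
    ∃ a, (∀ i, T.frame d v i = a + i) ∨ (∀ i, T.frame d v i = a - i) := by
  by_cases hv : v = T.root
  · subst hv
    exact ⟨d, Or.inl (T.frame_root d)⟩
  · simp only [T.frame_of_ne d hv]
    split_ifs
    · exact ⟨_, Or.inr fun i => rfl⟩
    · exact ⟨_, Or.inl fun i => rfl⟩

theorem frame_injective (d : Fin 6) (v : ι) : Function.Injective (T.frame d v) := by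
  obtain ⟨a, h | h⟩ := T.frame_cases d v <;> intro i j hij <;> rw [h, h] at hij
  · exact add_left_cancel hij
  · exact sub_right_injective hij

theorem frame_adj (d : Fin 6) (v : ι) (i j : Fin 6) :
    (T.frame d v j = T.frame d v i + 1 ∨ T.frame d v i = T.frame d v j + 1) ↔
      (j = i + 1 ∨ i = j + 1) := by
  obtain ⟨a, h | h⟩ := T.frame_cases d v <;> rw [h, h] <;> clear h <;> revert a i j <;> decide

/-- The positions `0` and `1` of a hexagon face its child. -/
theorem frame_down (hs : IsStraight G) {d : Fin 6}
    (hd : ∀ c, c ≠ T.root → T.parent c = T.root → T.down c = d) {w : ι} (hw : w ≠ T.root) :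
    (T.frame d (T.parent w) 0 = T.fst w ∧ T.frame d (T.parent w) 1 = T.snd w) ∨
      (T.frame d (T.parent w) 0 = T.snd w ∧ T.frame d (T.parent w) 1 = T.fst w) := by
  have h : (T.frame d (T.parent w) 0 = T.down w ∧ T.frame d (T.parent w) 1 = T.down w + 1) ∨
      (T.frame d (T.parent w) 0 = T.down w + 1 ∧ T.frame d (T.parent w) 1 = T.down w) := by
    by_cases hv : T.parent w = T.root
    · left
      rw [hv, T.frame_root, T.frame_root, hd w hw hv]
      simp
    · rw [T.frame_of_ne d hv, T.frame_of_ne d hv, T.down_eq_of_isStraight hs hw hv]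
      generalize T.up (T.parent w) = a
      split_ifs
      · right
        revert a; decide
      · left
        revert a; decide
  rcases T.ports w hw with ⟨h1, h2⟩ | ⟨h1, h2⟩ <;> rw [h1, h2] <;> tauto

/-- In the coordinates given by the frames, links look like those of the linear chain. -/
theorem adj_frame (hs : IsStraight G) {d : Fin 6}
    (hd : ∀ c, c ≠ T.root → T.parent c = T.root → T.down c = d) {w : ι} (hw : w ≠ T.root)
    (a b : Fin 6) :
    G.Adj (w, T.frame d w a) (T.parent w, T.frame d (T.parent w) b) ↔
      (b = 0 ∧ a = 4) ∨ (b = 1 ∧ a = 3) := by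
  have hinj := T.frame_injective d (T.parent w)
  rw [T.adj_parent w hw, T.frame_of_ne d hw]
  rcases T.frame_down hs hd hw with ⟨h0, h1⟩ | ⟨h0, h1⟩
  · rw [if_pos h0, ← h0, ← h1, hinj.eq_iff, hinj.eq_iff]
    generalize T.up w = c
    clear * -
    revert a b c; decide
  · have hne : T.frame d (T.parent w) 0 ≠ T.fst w := by
      rw [h0]
      exact (T.fst_ne_snd hw).symm
    rw [if_neg hne, ← h0, ← h1, hinj.eq_iff, hinj.eq_iff]
    generalize T.up w = c
    clear * -
    revert a b c; decide

end HexTree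

theorem nonempty_iso_linearPhenylene {h : ℕ} {G : SimpleGraph (Fin h × Fin 6)} (T : HexTree G)
    (hs : IsStraight G) (hleaf : IsLeaf G T.root) :
    Nonempty (G ≃g linearPhenylene h) := by
  obtain ⟨d, hd⟩ := T.down_eq_of_isLeaf hleaf
  have hinj : Function.Injective T.level := by
    refine T.level_injective fun v w hv hw hvw => ?_
    by_contra hne
    have h1 := (T.siblings v w hv hw hne hvw).1
    by_cases hp : T.parent w = T.root
    · exact h1 ((hd w hw hp).trans (hd v hv (hvw.trans hp)).symm)
    · refine h1 ((T.down_eq_of_isStraight hs hw hp).trans ?_)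
      rw [T.down_eq_of_isStraight hs hv (by rwa [hvw]), hvw]
  have hlt : ∀ v, T.level v < h := fun v => by simpa using T.level_lt_card v
  let lev : Fin h → Fin h := fun v => ⟨T.level v, hlt v⟩
  have hlev : Function.Injective lev := fun v w e => hinj (congrArg Fin.val e)
  let Φ : Fin h × Fin 6 → Fin h × Fin 6 := fun p => (p.1, T.frame d p.1 p.2)
  have hΦ : Function.Injective Φ := by
    rintro ⟨v, i⟩ ⟨w, j⟩ e
    obtain ⟨rfl, e2⟩ := Prod.mk.inj e
    exact Prod.ext rfl (T.frame_injective d v e2)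
  let Ψ : Fin h × Fin 6 → Fin h × Fin 6 := fun p => (lev p.1, p.2)
  have hΨ : Function.Injective Ψ := by
    rintro ⟨v, i⟩ ⟨w, j⟩ e
    obtain ⟨e1, rfl⟩ := Prod.mk.inj e
    exact Prod.ext (hlev e1) rfl
  let Φ' : Fin h × Fin 6 ≃ Fin h × Fin 6 :=
    Equiv.ofBijective Φ (Finite.injective_iff_bijective.1 hΦ)
  let Ψ' : Fin h × Fin 6 ≃ Fin h × Fin 6 :=
    Equiv.ofBijective Ψ (Finite.injective_iff_bijective.1 hΨ)
  have hchild : ∀ v w, w ≠ T.root → (T.level v + 1 = T.level w ↔ v = T.parent w) := by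
    intro v w hw
    rw [T.level_parent w hw, Nat.add_right_cancel_iff, hinj.eq_iff]
  have key : ∀ x y, (linearPhenylene h).Adj (Ψ x) (Ψ y) ↔ G.Adj (Φ x) (Φ y) := by
    rintro ⟨v, i⟩ ⟨w, j⟩
    change (linearPhenylene h).Adj (lev v, i) (lev w, j) ↔
      G.Adj (v, T.frame d v i) (w, T.frame d w j)
    by_cases hvw : v = w
    · subst hvw
      rw [linearPhenylene_adj_same, T.adj_same, T.frame_adj]
    · rw [linearPhenylene_adj_of_ne fun e => hvw (hlev e)]
      change ((T.level v + 1 = T.level w ∧ _) ∨ (T.level w + 1 = T.level v ∧ _)) ↔ _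
      constructor
      · rintro (⟨h1, h2⟩ | ⟨h1, h2⟩)
        · have hw : w ≠ T.root := by
            rintro rfl
            rw [T.level_root] at h1
            omega
          rw [hchild v w hw] at h1
          subst h1
          exact ((T.adj_frame hs hd hw j i).2 h2).symm
        · have hv : v ≠ T.root := by
            rintro rfl
            rw [T.level_root] at h1
            omega
          rw [hchild w v hv] at h1
          subst h1
          exact (T.adj_frame hs hd hv i j).2 h2
      · intro hadj
        rcases T.eq_parent v w _ _ hvw hadj with ⟨hv, rfl⟩ | ⟨hw, rfl⟩
        · exact Or.inr ⟨(hchild _ v hv).2 rfl, (T.adj_frame hs hd hv i j).1 hadj⟩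
        · exact Or.inl ⟨(hchild _ w hw).2 rfl, (T.adj_frame hs hd hw j i).1 hadj.symm⟩
  refine ⟨⟨Φ'.symm.trans Ψ', fun {x y} => ?_⟩⟩
  obtain ⟨x, rfl⟩ := Φ'.surjective x
  obtain ⟨y, rfl⟩ := Φ'.surjective y
  rw [Equiv.trans_apply, Equiv.trans_apply, Equiv.symm_apply_apply, Equiv.symm_apply_apply]
  exact key x y

/-- The lower bound for the Mostar index of tree-like phenylenes, with its equality case. -/
theorem linearMostar_le_mostarIndex {h : ℕ} (hh : 1 ≤ h) {V : Type*} [Fintype V]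
    {G : SimpleGraph V} (hG : IsTreeLikePhenylene G h) :
    linearMostar h ≤ mostarIndex G ∧
      (mostarIndex G = linearMostar h → Nonempty (G ≃g linearPhenylene h)) := by
  obtain ⟨G', quad, hP, ⟨f⟩⟩ := exists_iso_coordinates hG
  rw [← mostarIndex_iso f]
  have hne : Nonempty (Fin h) := ⟨⟨0, hh⟩⟩
  have hD := hexGraph_connected hP.connected
  obtain ⟨r, hr⟩ := Finite.exists_min fun r => ∑ u, (hexGraph G').dist u r
  obtain ⟨T, rfl, hlev⟩ := exists_hexTree hP r
  have hmain := T.linearMostar_le_of_balanced (T.two_mul_card_sub_le hD hlev hr)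
  rw [Fintype.card_fin] at hmain
  refine ⟨hmain.1, fun heq => ?_⟩
  obtain ⟨r', hleaf⟩ := T.exists_isLeaf
  obtain ⟨T', rfl, -⟩ := exists_hexTree hP r'
  obtain ⟨g⟩ := nonempty_iso_linearPhenylene T' (hmain.2 heq) hleaf
  exact ⟨f.symm.trans g⟩

theorem floor_half (h : ℕ) : ⌊(h : ℚ) / 2⌋ = ((h / 2 : ℕ) : ℤ) := by
  obtain ⟨b, rfl | rfl⟩ : ∃ b, h = 2 * b ∨ h = 2 * b + 1 := ⟨h / 2, by omega⟩
  · rw [show 2 * b / 2 = b by omega, Int.floor_eq_iff]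
    push_cast
    constructor <;> linarith
  · rw [show (2 * b + 1) / 2 = b by omega, Int.floor_eq_iff]
    push_cast
    constructor <;> linarith

theorem ceil_half (h : ℕ) : ⌈(h : ℚ) / 2⌉ = (((h + 1) / 2 : ℕ) : ℤ) := by
  obtain ⟨b, rfl | rfl⟩ : ∃ b, h = 2 * b ∨ h = 2 * b + 1 := ⟨h / 2, by omega⟩
  · rw [show (2 * b + 1) / 2 = b by omega, Int.ceil_eq_iff]
    push_cast
    constructor <;> linarith
  · rw [show (2 * b + 1 + 1) / 2 = b + 1 by omega, Int.ceil_eq_iff]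
    push_cast
    constructor <;> linarith

end Phenylene

theorem theorem3p5 (h : ℕ) (hh : 1 ≤ h) :
    IsTreeLikePhenylene (linearPhenylene h) h ∧
    mostarIndex (linearPhenylene h) =
      72 * ⌊(h : ℚ) / 2⌋ * ⌈(h : ℚ) / 2⌉ - 24 * ⌊(h : ℚ) / 2⌋ ∧
    ∀ (V : Type*) [Fintype V] (G : SimpleGraph V), IsTreeLikePhenylene G h →
      mostarIndex G ≥ mostarIndex (linearPhenylene h) ∧
      (mostarIndex G = mostarIndex (linearPhenylene h) ↔ Nonempty (G ≃g linearPhenylene h)) := by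
  have hL : mostarIndex (linearPhenylene h) = Phenylene.linearMostar h := by
    obtain ⟨n, rfl⟩ : ∃ n, h = n + 1 := ⟨h - 1, by omega⟩
    exact Phenylene.mostarIndex_linearPhenylene n
  refine ⟨?_, ?_, fun V _ G hG => ?_⟩
  · obtain ⟨n, rfl⟩ : ∃ n, h = n + 1 := ⟨h - 1, by omega⟩
    exact Phenylene.isTreeLikePhenylene_linearPhenylene n
  · rw [hL, Phenylene.floor_half, Phenylene.ceil_half]
    rfl
  · obtain ⟨h1, h2⟩ := Phenylene.linearMostar_le_mostarIndex hh hG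
    rw [hL]
    exact ⟨h1, h2, fun ⟨f⟩ => (Phenylene.mostarIndex_iso f).trans hL⟩
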